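/- Let $X$ be a real Hilbert space, $k\ge 1$, let $g_1,\dots,g_k:X\to\mathbb{R}\cup\{\pm\infty\}$ be proper, convex and lower semicontinuous, and let $\omega_1,\dots,\omega_k\in(0,1]$ satisfy $\sum_{i=1}^k\omega_i=1$. Write $\operatorname{dom} f=\{x: f(x)<+\infty\}$ and $f^*(u)=\sup_{x\in X}\{\langle u,x\rangle-f(x)\}$; let $\partial f(x)=\{u\in X: f(y)\ge f(x)+\langle u,y-x\rangle\ \forall y\in X\}$ if $f(x)\in\mathbb{R}$ and $\partial f(x)=\emptyset$ otherwise; and for $\gamma>0$ and $f$ proper, convex and lower semicontinuous let $\operatorname{prox}_{\gamma f}(x)$ be the unique minimizer of $y\mapsto f(y)+\frac1{2\gamma}\|y-x\|^2$. For a convex set $C$ let $\operatorname{sqri} C=\{x\in C:\bigcup_{\lambda>0}\lambda(C-x)\text{ is a closed linear subspace}\}$. Consider the primal problem $$\inf_{x\in X}\ \sum_{i=1}^k\omega_i g_i(x)\qquad (P)$$ and its dual problem $$\sup\Big\{\sum_{i=1}^k-\omega_i g_i^*(y_i)\ :\ (y_1,\dots,y_k)\in X^k,\ \sum_{i=1}^k\omega_i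 y_i=0\Big\}.\qquad (D)$$ Let $C=\prod_{i=1}^k\operatorname{dom} g_i-\{(x,\dots,x):x\in X\}\subseteq X^k$. Assume that $(P)$ has an optimal solution $\hat x$ and that at least one of the following holds: - (QC1) there is $x'\in\bigcap_{i=1}^k\operatorname{dom} g_i$ such that every $g_i$ is continuous at $x'$; - (QC2) $0\in\operatorname{int} C$; - (QC3) $0\in\operatorname{sqri} C$. Then: (i) There is an optimal solution $(\hat y_1,\dots,\hat y_k)$ of $(D)$, the optimal values of $(P)$ and $(D)$ coincide, and $\hat x\in\partial g_i^*(\hat y_i)$ for $i=1,\dots,k$, and $\sum_{i=1}^k\omega_i\hat y_i=0$. (ii) Suppose $X$ is finite-dimensional. Let $\sigma,\tau>0$ with $\sigma\tau<1$, let $(x^0,y_1^0,\dots,y_k^0)\in X^{k+1}$ be arbitrary, put $\bar x^0=x^0$ and, for $n\ge 0$, $$y_i^{n+1}=\operatorname{prox}_{\sigma g_i^*}(y_i^n+\sigma\bar x^n)\ (i=1,\dots,k),\qquad x^{n+1}=x^n-\tau\sum_{i=1}^k\omega_i y_i^{n+1},\qquad \bar x^{n+1}=2x^{n+1}-x^n.$$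 Then $(x^n)$ converges to an optimal solution of $(P)$ and $(y_1^n,\dots,y_k^n)$ converges to an optimal solution of $(D)$. (iii) Suppose $X$ is finite-dimensional. Let $\sigma,\tau>0$ with $\sigma\tau<1$, let $(x_1^0,\dots,x_k^0,y_1^0,\dots,y_k^0)\in X^{2k}$ be arbitrary, put $\bar x_i^0=x_i^0$ and, for $n\ge0$ and $i=1,\dots,k$, $$y_i^{n+1}=y_i^n-\sigma\bar x_i^n-\sum_{j=1}^k\omega_j y_j^n+\sigma\sum_{j=1}^k\omega_j\bar x_j^n,\qquad x_i^{n+1}=\operatorname{prox}_{\tau g_i}(x_i^n+\tau y_i^{n+1}),\qquad \bar x_i^{n+1}=2x_i^{n+1}-x_i^n.$$ Then for every $i=1,\dots,k$ the sequence $(x_i^n)$ converges to an optimal solution of $(P)$, and $(y_1^n,\dots,y_k^n)$ converges to an optimal solution of $(D)$. -/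

import Mathlib

open Filter Topology

noncomputable section

namespace PrimalDual

variable {X : Type*} [NormedAddCommGroup X] [InnerProductSpace ℝ X]

/-- The effective domain of an extended-real-valued function. -/
def effDom (f : X → EReal) : Set X := {x | f x < ⊤}

/-- A proper function: nonempty effective domain, and the value `-∞` is never taken. -/
def IsProper (f : X → EReal) : Prop := (effDom f).Nonempty ∧ ∀ x, ⊥ < f x

/-- Convexity of an extended-real-valued function: its epigraph is convex. -/
def IsConvexFun (f : X → EReal) : Prop := Convex ℝ {p : X × ℝ | f p.1 ≤ (p.2 : EReal)}

/-- The conjugate function `f^*(u) = sup_x (⟨u, x⟩ - f x)`. -/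
def conjugate (f : X → EReal) (u : X) : EReal := ⨆ x : X, ((inner ℝ u x : ℝ) : EReal) - f x

/-- The convex subdifferential; it is empty where `f` is not finite. -/
def subdifferential (f : X → EReal) (x : X) : Set X :=
  {u | f x ≠ ⊤ ∧ f x ≠ ⊥ ∧ ∀ y, f x + ((inner ℝ u (y - x) : ℝ) : EReal) ≤ f y}

/-- `p` minimizes `y ↦ f y + ‖y - x‖² / (2γ)` over the whole space. -/
def IsProx (γ : ℝ) (f : X → EReal) (x p : X) : Prop :=
  ∀ y, f p + ((1 / (2 * γ) * ‖p - x‖ ^ 2 : ℝ) : EReal)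
    ≤ f y + ((1 / (2 * γ) * ‖y - x‖ ^ 2 : ℝ) : EReal)

/-- The proximal point of parameter `γ` of `f` at `x` (for `γ > 0` and `f` proper, convex and
lower semicontinuous on a Hilbert space, the unique point satisfying `IsProx γ f x`). -/
def prox (γ : ℝ) (f : X → EReal) (x : X) : X := Classical.epsilon (IsProx γ f x)

/-- The strong quasi-relative interior of `C`: the points `x ∈ C` such that
`⋃_{t > 0} t (C - x)` is a closed linear subspace. -/
def sqri {E : Type*} [AddCommGroup E] [Module ℝ E] [TopologicalSpace E] (C : Set E) : Set E :=
  {x | x ∈ C ∧ ∃ S : Submodule ℝ E, IsClosed (S : Set E) ∧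
    (S : Set E) = {z | ∃ t : ℝ, 0 < t ∧ ∃ c ∈ C, z = t • (c - x)}}

variable {k : ℕ}

/-- The primal objective `x ↦ ∑ ω_i g_i(x)`. -/
def primalObj (ω : Fin k → ℝ) (g : Fin k → X → EReal) (x : X) : EReal :=
  ∑ i, (ω i : EReal) * g i x

/-- The dual objective `(y_1, …, y_k) ↦ ∑ -ω_i g_i^*(y_i)`. -/
def dualObj (ω : Fin k → ℝ) (g : Fin k → X → EReal) (y : Fin k → X) : EReal :=
  ∑ i, -((ω i : EReal) * conjugate (g i) (y i))

/-- The feasible set of the dual problem: `∑ ω_i y_i = 0`. -/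
def dualFeasible (ω : Fin k → ℝ) : Set (Fin k → X) := {y | ∑ i, ω i • y i = 0}

/-- `x` is an optimal solution of `inf_x ∑ ω_i g_i(x)`. -/
def IsPrimalSolution (ω : Fin k → ℝ) (g : Fin k → X → EReal) (x : X) : Prop :=
  ∀ z, primalObj ω g x ≤ primalObj ω g z

/-- `y` is an optimal solution of the dual problem. -/
def IsDualSolution (ω : Fin k → ℝ) (g : Fin k → X → EReal) (y : Fin k → X) : Prop :=
  y ∈ dualFeasible ω ∧ ∀ z ∈ dualFeasible ω, dualObj ω g z ≤ dualObj ω g y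

/-- The optimal objective value of the primal problem. -/
def primalValue (ω : Fin k → ℝ) (g : Fin k → X → EReal) : EReal := ⨅ x, primalObj ω g x

/-- The optimal objective value of the dual problem. -/
def dualValue (ω : Fin k → ℝ) (g : Fin k → X → EReal) : EReal :=
  ⨆ y ∈ dualFeasible (X := X) ω, dualObj ω g y

/-- The set `∏ dom g_i - {(x, …, x) : x ∈ X}`. -/
def domDiff (g : Fin k → X → EReal) : Set (Fin k → X) :=
  {z | ∃ d : Fin k → X, (∀ i, d i ∈ effDom (g i)) ∧ ∃ x : X, z = fun i => d i - x}

/-- First qualification condition. -/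
def QC1 (g : Fin k → X → EReal) : Prop :=
  ∃ x', ∀ i, x' ∈ effDom (g i) ∧ ContinuousAt (g i) x'

/-- Second qualification condition. -/
def QC2 (g : Fin k → X → EReal) : Prop := (0 : Fin k → X) ∈ interior (domDiff g)

/-- Third qualification condition. -/
def QC3 (g : Fin k → X → EReal) : Prop := (0 : Fin k → X) ∈ sqri (domDiff g)

/-- `(x^n, xbar^n, y^n)` is generated by the first algorithm, with step sizes `σ, τ` and the
arbitrary starting point `(x 0, y 0)`. -/
structure GeneratedByFirst (ω : Fin k → ℝ) (g : Fin k → X → EReal) (σ τ : ℝ)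
    (x xbar : ℕ → X) (y : ℕ → Fin k → X) : Prop where
  xbar_zero : xbar 0 = x 0
  y_succ : ∀ n i, y (n + 1) i = prox σ (conjugate (g i)) (y n i + σ • xbar n)
  x_succ : ∀ n, x (n + 1) = x n - τ • ∑ i, ω i • y (n + 1) i
  xbar_succ : ∀ n, xbar (n + 1) = (2 : ℝ) • x (n + 1) - x n

/-- `(x_i^n, xbar_i^n, y_i^n)` is generated by the second algorithm, with step sizes `σ, τ` and
the arbitrary starting point `(x 0, y 0)`. -/
structure GeneratedBySecond (ω : Fin k → ℝ) (g : Fin k → X → EReal) (σ τ : ℝ)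
    (x xbar y : ℕ → Fin k → X) : Prop where
  xbar_zero : ∀ i, xbar 0 i = x 0 i
  y_succ : ∀ n i, y (n + 1) i =
    y n i - σ • xbar n i - ∑ j, ω j • y n j + σ • ∑ j, ω j • xbar n j
  x_succ : ∀ n i, x (n + 1) i = prox τ (g i) (x n i + τ • y (n + 1) i)
  xbar_succ : ∀ n i, xbar (n + 1) i = (2 : ℝ) • x (n + 1) i - x n i

end PrimalDual

end

open PrimalDual

/-! Everything rests on the optimality system y_i ∈ ∂g_i(x), ∑ ω_i y_i = 0. A solution of it is
optimal on both sides with equal values: the Fenchel–Young inequalities become equalities and the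
linear terms cancel (`optimal_of_subdifferential`).

For (i), QC1 implies QC2, which implies QC3, and QC3 yields a solution at `xhat`
(`exists_subdifferential_of_qc3`). The perturbation function z ↦ inf_x ∑ ω_i g_i(x + z_i) is bounded
above near 0 on the closed subspace S generated by `domDiff g`, by a Baire argument on closed convex
sets (`exists_ball_subset_boundedPerturbations`). Separation then gives a continuous subgradient at
0 on S; extended to X^k and rescaled by the weights, it is y.

For (ii) and (iii), both algorithms are proximal point iterations for the optimality system on the
pairs (x^n, y^{n+1}), in the metric `stepForm` with s = 1 and s = -1. The condition στ < 1 makes the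
metric positive definite, monotonicity of subdifferentials makes the iterates Fejér monotone,
closedness of their graphs puts cluster points in `saddleSet`, and (i) makes that set nonempty;
`exists_tendsto_of_fejer` concludes. -/

namespace PrimalDual

/-! ### Subdifferentials, conjugates and proximal points -/

section ConvexAnalysis

variable {X : Type*} [NormedAddCommGroup X] [InnerProductSpace ℝ X]

theorem ereal_le_of_forall_real_ge {c e : EReal} (h : ∀ b : ℝ, e ≤ b → c ≤ b) : c ≤ e := by
  induction e with
  | top => exact le_top
  | coe r => exact h r le_rfl
  | bot =>
    induction c with
    | bot => exact le_rfl
    | top => exact absurd (h 0 bot_le) (by simp)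
    | coe r =>
      have h1 := h (r - 1) bot_le
      rw [EReal.coe_le_coe_iff] at h1
      linarith

theorem IsConvexFun.le_combo {f : X → EReal} (hf : IsConvexFun f) {x y : X} {a b s t : ℝ}
    (hx : f x ≤ a) (hy : f y ≤ b) (hs : 0 ≤ s) (ht : 0 ≤ t) (hst : s + t = 1) :
    f (s • x + t • y) ≤ ((s * a + t * b : ℝ) : EReal) := by
  have h := hf (x := (x, a)) hx (y := (y, b)) hy hs ht hst
  simpa using h

theorem IsProper.exists_real {E : Type*} {f : E → EReal} (hf : IsProper f) {x : E} (hx : f x < ⊤) :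
    ∃ a : ℝ, f x = a :=
  ⟨(f x).toReal, (EReal.coe_toReal hx.ne (hf.2 x).ne').symm⟩

/-- Testing against real upper bounds of `f y` keeps all later arithmetic in ℝ; points with value
`⊤` impose nothing. -/
theorem mem_subdifferential_iff {f : X → EReal} {x u : X} :
    u ∈ subdifferential f x ↔
      ∃ a : ℝ, f x = a ∧ ∀ y (b : ℝ), f y ≤ b → a + inner ℝ u (y - x) ≤ b := by
  constructor
  · rintro ⟨h1, h2, h3⟩
    refine ⟨(f x).toReal, (EReal.coe_toReal h1 h2).symm, fun y b hb => ?_⟩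
    have h4 := (h3 y).trans hb
    rw [← EReal.coe_toReal h1 h2, ← EReal.coe_add, EReal.coe_le_coe_iff] at h4
    exact h4
  · rintro ⟨a, ha, h⟩
    refine ⟨by simp [ha], by simp [ha], fun y => ?_⟩
    apply ereal_le_of_forall_real_ge
    intro b hb
    rw [ha, ← EReal.coe_add, EReal.coe_le_coe_iff]
    exact h y b hb

theorem subdifferential_monotone {f : X → EReal} {x y u v : X} (hu : u ∈ subdifferential f x)
    (hv : v ∈ subdifferential f y) : 0 ≤ inner ℝ (u - v) (x - y) := by
  obtain ⟨a, ha, h⟩ := mem_subdifferential_iff.1 hu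
  obtain ⟨b, hb, h'⟩ := mem_subdifferential_iff.1 hv
  have h1 := h y b hb.le
  have h2 := h' x a ha.le
  simp only [inner_sub_left, inner_sub_right] at *
  linarith

/-- Lower semicontinuity passes the subgradient inequality to the limit; finiteness at `x'` follows
by testing it at one point of the domain. -/
theorem mem_subdifferential_of_tendsto {f : X → EReal} (hf : IsProper f)
    (hlsc : LowerSemicontinuous f) {x u : ℕ → X} {x' u' : X}
    (h : ∀ n, u n ∈ subdifferential f (x n)) (hx : Tendsto x atTop (𝓝 x'))
    (hu : Tendsto u atTop (𝓝 u')) : u' ∈ subdifferential f x' := by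
  have key : ∀ y (b : ℝ), f y ≤ b → f x' ≤ ((b - inner ℝ u' (y - x') : ℝ) : EReal) := by
    intro y b hb
    by_contra! hlt
    obtain ⟨c, hc1, hc2⟩ := EReal.lt_iff_exists_real_btwn.1 hlt
    have hlim : Tendsto (fun n => b - inner ℝ (u n) (y - x n)) atTop
        (𝓝 (b - inner ℝ u' (y - x'))) :=
      tendsto_const_nhds.sub (hu.inner (tendsto_const_nhds.sub hx))
    have e1 := hlim.eventually_lt_const (EReal.coe_lt_coe_iff.1 hc1)
    have e2 := hx.eventually (hlsc x' c hc2)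
    obtain ⟨n, hn1, hn2⟩ := (e1.and e2).exists
    obtain ⟨a, ha, h'⟩ := mem_subdifferential_iff.1 (h n)
    have h3 := h' y b hb
    rw [ha, gt_iff_lt, EReal.coe_lt_coe_iff] at hn2
    linarith
  obtain ⟨y₀, hy₀⟩ := hf.1
  obtain ⟨b₀, hb₀⟩ := hf.exists_real hy₀
  obtain ⟨a, ha⟩ := hf.exists_real ((key y₀ b₀ hb₀.le).trans_lt (EReal.coe_lt_top _))
  refine mem_subdifferential_iff.2 ⟨a, ha, fun y b hb => ?_⟩
  have h4 := key y b hb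
  rw [ha, EReal.coe_le_coe_iff] at h4
  linarith

theorem conjugate_le_coe_iff {f : X → EReal} {u : X} {c : ℝ} :
    conjugate f u ≤ c ↔ ∀ x (b : ℝ), f x ≤ b → inner ℝ u x - b ≤ c := by
  unfold conjugate
  rw [iSup_le_iff]
  refine forall_congr' fun x => ?_
  constructor
  · intro h b hb
    have h1 : ((inner ℝ u x : ℝ) : EReal) - b ≤ c := (EReal.sub_le_sub le_rfl hb).trans h
    rw [← EReal.coe_sub, EReal.coe_le_coe_iff] at h1
    exact h1
  · intro h
    induction hfx : f x with
    | top => simp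
    | coe r =>
      rw [← EReal.coe_sub, EReal.coe_le_coe_iff]
      exact h r hfx.le
    | bot =>
      exfalso
      have := h (inner ℝ u x - c - 1) (by simp [hfx])
      linarith

theorem inner_sub_le_conjugate {f : X → EReal} {x u : X} {a : ℝ} (ha : f x ≤ a) :
    ((inner ℝ u x - a : ℝ) : EReal) ≤ conjugate f u := by
  refine le_trans ?_ (le_iSup _ x)
  rw [EReal.coe_sub]
  exact EReal.sub_le_sub le_rfl ha

theorem conjugate_eq_of_mem_subdifferential {f : X → EReal} {x u : X} {a : ℝ}
    (hu : u ∈ subdifferential f x) (ha : f x = a) :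
    conjugate f u = ((inner ℝ u x - a : ℝ) : EReal) := by
  refine le_antisymm (conjugate_le_coe_iff.2 fun y b hb => ?_) (inner_sub_le_conjugate ha.le)
  obtain ⟨a', ha', h⟩ := mem_subdifferential_iff.1 hu
  rw [ha, EReal.coe_eq_coe_iff] at ha'
  have := h y b hb
  rw [inner_sub_right] at this
  linarith

theorem mem_subdifferential_conjugate {f : X → EReal} {x u : X}
    (hu : u ∈ subdifferential f x) : x ∈ subdifferential (conjugate f) u := by
  obtain ⟨a, ha, -⟩ := mem_subdifferential_iff.1 hu
  refine mem_subdifferential_iff.2 ⟨_, conjugate_eq_of_mem_subdifferential hu ha, fun v b hb => ?_⟩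
  have h := (inner_sub_le_conjugate (u := v) ha.le).trans hb
  rw [EReal.coe_le_coe_iff] at h
  rw [inner_sub_right, real_inner_comm u x, real_inner_comm v x]
  linarith

/-- A proper convex lower semicontinuous function has a continuous affine minorant. -/
theorem exists_affine_minorant [CompleteSpace X] {f : X → EReal} (hf : IsProper f)
    (hconv : IsConvexFun f) (hlsc : LowerSemicontinuous f) :
    ∃ (u : X) (c : ℝ), ∀ x (b : ℝ), f x ≤ b → inner ℝ u x - b ≤ c := by
  obtain ⟨x₀, hx₀⟩ := hf.1
  obtain ⟨a, ha⟩ := hf.exists_real hx₀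
  have hclosed : IsClosed {p : X × ℝ | f p.1 ≤ (p.2 : EReal)} := by
    have h1 : Continuous fun p : X × ℝ => ((p.1, (p.2 : EReal)) : X × EReal) :=
      continuous_fst.prodMk (continuous_coe_real_ereal.comp continuous_snd)
    exact hlsc.isClosed_epigraph.preimage h1
  have hnot : (x₀, a - 1) ∉ {p : X × ℝ | f p.1 ≤ (p.2 : EReal)} := by
    simp only [Set.mem_ofPred_eq, ha, EReal.coe_le_coe_iff]
    linarith
  obtain ⟨φ, r, hφ, hr⟩ := geometric_hahn_banach_point_closed hconv hclosed hnot
  have hsplit : ∀ (x : X) (t : ℝ), φ (x, t) = φ (x, 0) + t * φ (0, 1) := by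
    intro x t
    have h1 : ((x, t) : X × ℝ) = (x, 0) + t • (0, 1) := by simp
    rw [h1, map_add, map_smul, smul_eq_mul]
  set β := φ (0, 1)
  have h0 := hr (x₀, a) (by simp [ha])
  rw [hsplit] at h0 hφ
  -- The separating hyperplane is not vertical: it separates two points on the vertical line over
  -- `x₀`.
  have hβ : 0 < β := by nlinarith
  let ψ : X →L[ℝ] ℝ := φ.comp (ContinuousLinearMap.inl ℝ X ℝ)
  refine ⟨(-β⁻¹) • (InnerProductSpace.toDual ℝ X).symm ψ, -β⁻¹ * r, fun x b hb => ?_⟩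
  have h2 := hr (x, b) hb
  rw [hsplit] at h2
  rw [inner_smul_left, InnerProductSpace.toDual_symm_apply]
  have h3 : ψ x = φ (x, 0) := rfl
  rw [h3]
  have h4 : β⁻¹ * r ≤ β⁻¹ * (φ (x, 0) + b * β) :=
    mul_le_mul_of_nonneg_left h2.le (inv_nonneg.2 hβ.le)
  have h5 : β⁻¹ * (φ (x, 0) + b * β) = β⁻¹ * φ (x, 0) + b := by field_simp
  simp only [conj_trivial]
  linarith

theorem isProper_conjugate [CompleteSpace X] {f : X → EReal} (hf : IsProper f)
    (hconv : IsConvexFun f) (hlsc : LowerSemicontinuous f) : IsProper (conjugate f) := by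
  obtain ⟨u, c, h⟩ := exists_affine_minorant hf hconv hlsc
  obtain ⟨x₀, hx₀⟩ := hf.1
  obtain ⟨a, ha⟩ := hf.exists_real hx₀
  exact ⟨⟨u, (conjugate_le_coe_iff.2 h).trans_lt (EReal.coe_lt_top c)⟩, fun v =>
    (EReal.bot_lt_coe _).trans_le (inner_sub_le_conjugate ha.le)⟩

theorem isConvexFun_conjugate (f : X → EReal) : IsConvexFun (conjugate f) := by
  rintro ⟨u, s⟩ hu ⟨v, t⟩ hv α β hα hβ hαβ
  simp only [Set.mem_ofPred_eq, Prod.smul_mk, Prod.mk_add_mk] at hu hv ⊢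
  rw [conjugate_le_coe_iff] at hu hv ⊢
  intro x b hb
  have h1 := mul_le_mul_of_nonneg_left (hu x b hb) hα
  have h2 := mul_le_mul_of_nonneg_left (hv x b hb) hβ
  simp only [inner_add_left, inner_smul_left, smul_eq_mul, conj_trivial]
  have h3 : b = α * b + β * b := by rw [← add_mul, hαβ, one_mul]
  linarith

theorem lowerSemicontinuous_conjugate (f : X → EReal) : LowerSemicontinuous (conjugate f) := by
  refine lowerSemicontinuous_iSup fun x => Continuous.lowerSemicontinuous ?_
  induction f x with
  | top => simpa using continuous_const
  | coe r =>
    simp only [← EReal.coe_sub]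
    exact continuous_coe_real_ereal.comp (by fun_prop)
  | bot => simpa using continuous_const

theorem exists_isProx [FiniteDimensional ℝ X] {γ : ℝ} (hγ : 0 < γ) {f : X → EReal}
    (hf : IsProper f) (hconv : IsConvexFun f) (hlsc : LowerSemicontinuous f) (x : X) :
    ∃ p, IsProx γ f x p := by
  have : CompleteSpace X := FiniteDimensional.complete ℝ X
  have : ProperSpace X := FiniteDimensional.proper ℝ X
  obtain ⟨u, c, hu⟩ := exists_affine_minorant hf hconv hlsc
  obtain ⟨x₀, hx₀⟩ := hf.1
  obtain ⟨a, ha⟩ := hf.exists_real hx₀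
  set δ : ℝ := 1 / (2 * γ) with hδ
  have hδ0 : 0 < δ := by positivity
  set F : X → EReal := fun y => f y + ((δ * ‖y - x‖ ^ 2 : ℝ) : EReal) with hF
  have hFlsc : LowerSemicontinuous F := by
    refine LowerSemicontinuous.add' hlsc
      (Continuous.lowerSemicontinuous (continuous_coe_real_ereal.comp (by fun_prop))) fun y => ?_
    exact EReal.continuousAt_add (Or.inr (EReal.coe_ne_bot _)) (Or.inr (EReal.coe_ne_top _))
  set m : ℝ := a + δ * ‖x₀ - x‖ ^ 2 with hm
  have hFx₀ : F x₀ = (m : EReal) := by simp only [hF, ha, hm, EReal.coe_add]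
  -- the sublevel set of `F` at `m` is bounded
  set K : ℝ := |m + c - inner ℝ u x| with hK
  -- Chosen so that δt² ≤ ‖u‖t + K fails for t > R: here δR ≥ ‖u‖ + K + 1 and R ≥ 1.
  set R : ℝ := (‖u‖ + K + 1) / δ + 1 with hR
  have hbound : ∀ y, F y ≤ m → ‖y - x‖ ≤ R := by
    intro y hy
    have hfy : f y < ⊤ := by
      by_contra h
      rw [not_lt_top_iff] at h
      simp only [hF, h, EReal.top_add_coe, top_le_iff] at hy
      exact EReal.coe_ne_top _ hy
    obtain ⟨b, hb⟩ := hf.exists_real hfy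
    simp only [hF, hb] at hy
    rw [← EReal.coe_add, EReal.coe_le_coe_iff] at hy
    have h1 := hu y b hb.le
    have h2 : inner ℝ u y = inner ℝ u x + inner ℝ u (y - x) := by rw [inner_sub_right]; ring
    have h3 : -(‖u‖ * ‖y - x‖) ≤ inner ℝ u (y - x) :=
      neg_le_of_abs_le (abs_real_inner_le_norm u (y - x))
    have h4 : m + c - inner ℝ u x ≤ K := le_abs_self _
    have h5 : δ * ‖y - x‖ ^ 2 ≤ ‖u‖ * ‖y - x‖ + K := by linarith
    by_contra! hlt
    have hK0 : 0 ≤ K := abs_nonneg _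
    have hu0 := norm_nonneg u
    have h6 : 1 ≤ R := by rw [hR]; linarith [show 0 ≤ (‖u‖ + K + 1) / δ by positivity]
    have h7 : ‖u‖ + K + 1 ≤ δ * R := by
      rw [hR, mul_add, mul_div_cancel₀ _ hδ0.ne']; linarith
    have h8 : δ * R ≤ δ * ‖y - x‖ := mul_le_mul_of_nonneg_left hlt.le hδ0.le
    nlinarith
  obtain ⟨p, -, hp⟩ := LowerSemicontinuousOn.exists_isMinOn (f := F)
    (s := Metric.closedBall x R) ⟨x₀, by
      rw [Metric.mem_closedBall, dist_eq_norm]; exact hbound x₀ hFx₀.le⟩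
    (isCompact_closedBall x R) (hFlsc.lowerSemicontinuousOn _)
  refine ⟨p, fun y => ?_⟩
  change F p ≤ F y
  rcases le_total (F y) m with h | h
  · exact hp (by simpa [dist_eq_norm] using hbound y h)
  · refine le_trans ?_ h
    rw [← hFx₀]
    exact hp (by simpa [dist_eq_norm] using hbound x₀ hFx₀.le)

/-- Compare `p` with p + t(y - p), divide by t and let t ↓ 0: the quadratic remainder vanishes. -/
theorem IsProx.mem_subdifferential {γ : ℝ} (hγ : 0 < γ) {f : X → EReal} (hf : IsProper f)
    (hconv : IsConvexFun f) {x p : X} (hp : IsProx γ f x p) :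
    γ⁻¹ • (x - p) ∈ subdifferential f p := by
  obtain ⟨x₀, hx₀⟩ := hf.1
  obtain ⟨a₀, ha₀⟩ := hf.exists_real hx₀
  have hfp : f p < ⊤ := by
    have h := hp x₀
    by_contra h'
    rw [not_lt_top_iff] at h'
    rw [h', ha₀, ← EReal.coe_add, EReal.top_add_coe, top_le_iff] at h
    exact EReal.coe_ne_top _ h
  obtain ⟨a, ha⟩ := hf.exists_real hfp
  refine mem_subdifferential_iff.2 ⟨a, ha, fun y b hb => ?_⟩
  have key : ∀ t : ℝ, 0 < t → t ≤ 1 →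
      a + inner ℝ (γ⁻¹ • (x - p)) (y - p) - b ≤ t * (1 / (2 * γ) * ‖y - p‖ ^ 2) := by
    intro t ht ht1
    have h1 := hconv.le_combo ha.le hb (sub_nonneg.2 ht1) ht.le (by ring)
    have h2 := (hp ((1 - t) • p + t • y)).trans (add_le_add_left h1 _)
    rw [ha, ← EReal.coe_add, ← EReal.coe_add, EReal.coe_le_coe_iff] at h2
    have h3 : (1 - t) • p + t • y - x = (p - x) + t • (y - p) := by module
    rw [h3, norm_add_sq_real, norm_smul, inner_smul_right, mul_pow, Real.norm_eq_abs,
      sq_abs] at h2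
    have h4 : inner ℝ (γ⁻¹ • (x - p)) (y - p) = -(γ⁻¹ * inner ℝ (p - x) (y - p)) := by
      rw [inner_smul_left, ← neg_sub p x, inner_neg_left]; simp
    rw [h4]
    have h5 : t * (a + -(γ⁻¹ * inner ℝ (p - x) (y - p)) - b)
        ≤ t * (t * (1 / (2 * γ) * ‖y - p‖ ^ 2)) := by
      have h6 : γ⁻¹ = 2 * (1 / (2 * γ)) := by field_simp
      rw [h6]
      nlinarith
    exact le_of_mul_le_mul_left h5 ht
  have hlim : Tendsto (fun t : ℝ => t * (1 / (2 * γ) * ‖y - p‖ ^ 2)) (𝓝[>] 0) (𝓝 0) := by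
    have : Continuous fun t : ℝ => t * (1 / (2 * γ) * ‖y - p‖ ^ 2) := by fun_prop
    simpa using (this.tendsto 0).mono_left nhdsWithin_le_nhds
  have := ge_of_tendsto hlim (a := 0)
    (b := a + inner ℝ (γ⁻¹ • (x - p)) (y - p) - b) (by
      filter_upwards [Ioc_mem_nhdsGT (zero_lt_one' ℝ)] with t ht using key t ht.1 ht.2)
  linarith

theorem prox_mem_subdifferential [FiniteDimensional ℝ X] {γ : ℝ} (hγ : 0 < γ) {f : X → EReal}
    (hf : IsProper f) (hconv : IsConvexFun f) (hlsc : LowerSemicontinuous f) (x : X) :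
    γ⁻¹ • (x - prox γ f x) ∈ subdifferential f (prox γ f x) :=
  IsProx.mem_subdifferential hγ hf hconv
    (Classical.epsilon_spec (exists_isProx hγ hf hconv hlsc x))

/-- Minty's argument replaces biconjugation: p = prox(x + u) satisfies x + u - p ∈ ∂f(p), and
monotonicity of ∂f* against x ∈ ∂f*(u) gives 0 ≤ -‖x - p‖². -/
theorem mem_subdifferential_of_mem_conjugate [FiniteDimensional ℝ X] {f : X → EReal}
    (hf : IsProper f) (hconv : IsConvexFun f) (hlsc : LowerSemicontinuous f) {x u : X}
    (hx : x ∈ subdifferential (conjugate f) u) : u ∈ subdifferential f x := by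
  have h1 := prox_mem_subdifferential one_pos hf hconv hlsc (x + u)
  set p := prox 1 f (x + u)
  rw [inv_one, one_smul] at h1
  have h2 := subdifferential_monotone hx (mem_subdifferential_conjugate h1)
  have h3 : u - (x + u - p) = -(x - p) := by abel
  rw [h3, inner_neg_right, real_inner_self_eq_norm_sq] at h2
  have h4 : x - p = 0 := by
    rw [← norm_eq_zero]
    exact pow_eq_zero_iff two_ne_zero |>.1 (le_antisymm (by linarith) (sq_nonneg _))
  have h5 : p = x := (sub_eq_zero.1 h4).symm
  rw [h5] at h1
  simpa using h1

theorem prox_conjugate_mem_subdifferential [FiniteDimensional ℝ X] {γ : ℝ} (hγ : 0 < γ)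
    {f : X → EReal} (hf : IsProper f) (hconv : IsConvexFun f) (hlsc : LowerSemicontinuous f)
    (x : X) :
    prox γ (conjugate f) x ∈ subdifferential f (γ⁻¹ • (x - prox γ (conjugate f) x)) := by
  have : CompleteSpace X := FiniteDimensional.complete ℝ X
  exact mem_subdifferential_of_mem_conjugate hf hconv hlsc
    (prox_mem_subdifferential hγ (isProper_conjugate hf hconv hlsc) (isConvexFun_conjugate f)
      (lowerSemicontinuous_conjugate f) x)

end ConvexAnalysis

/-! ### Weak duality and sufficiency of the optimality system -/

section Duality

variable {X : Type*} [NormedAddCommGroup X] [InnerProductSpace ℝ X] {k : ℕ}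

theorem coe_real_sum {ι : Type*} (s : Finset ι) (f : ι → ℝ) :
    ((∑ i ∈ s, f i : ℝ) : EReal) = ∑ i ∈ s, (f i : EReal) := by
  induction s using Finset.cons_induction with
  | empty => simp
  | cons a s ha ih => rw [Finset.sum_cons, Finset.sum_cons, EReal.coe_add, ih]

/-- Weak duality. -/
theorem dualObj_le_primalObj {ω : Fin k → ℝ} (hω : ∀ i, 0 < ω i) {g : Fin k → X → EReal}
    (hproper : ∀ i, IsProper (g i)) {z : Fin k → X} (hz : z ∈ dualFeasible ω) (x : X) :
    dualObj ω g z ≤ primalObj ω g x := by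
  -- Weighted Fenchel–Young; the linear terms stay real and cancel in the sum by dual feasibility.
  have hterm : ∀ i, -((ω i : EReal) * conjugate (g i) (z i))
      ≤ (ω i : EReal) * g i x + ((-(ω i * inner ℝ (z i) x) : ℝ) : EReal) := by
    intro i
    rcases eq_or_ne (g i x) ⊤ with h | h
    · rw [h, EReal.coe_mul_top_of_pos (hω i), EReal.top_add_coe]
      exact le_top
    · obtain ⟨a, ha⟩ := (hproper i).exists_real (lt_top_iff_ne_top.2 h)
      have h1 := mul_le_mul_of_nonneg_left (inner_sub_le_conjugate (u := z i) ha.le)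
        (EReal.coe_nonneg.2 (hω i).le)
      rw [ha, ← EReal.coe_mul, ← EReal.coe_add]
      refine (EReal.neg_le_neg_iff.2 h1).trans ?_
      rw [← EReal.coe_mul, ← EReal.coe_neg, EReal.coe_le_coe_iff]
      linarith
  have hsum : ∑ i, -(ω i * inner ℝ (z i) x) = 0 := by
    have h : ∑ i, ω i • z i = 0 := hz
    have h2 : inner ℝ (∑ i, ω i • z i) x = 0 := by rw [h, inner_zero_left]
    simp only [sum_inner, inner_smul_left, conj_trivial] at h2
    rw [Finset.sum_neg_distrib, h2, neg_zero]
  calc dualObj ω g z ≤ ∑ i, ((ω i : EReal) * g i x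
        + ((-(ω i * inner ℝ (z i) x) : ℝ) : EReal)) := Finset.sum_le_sum fun i _ => hterm i
    _ = primalObj ω g x := by
      rw [Finset.sum_add_distrib, ← coe_real_sum, hsum, EReal.coe_zero, add_zero, primalObj]

theorem dualObj_eq_primalObj {ω : Fin k → ℝ} {g : Fin k → X → EReal} {x : X} {y : Fin k → X}
    (hy : y ∈ dualFeasible ω) (hsub : ∀ i, y i ∈ subdifferential (g i) x) :
    dualObj ω g y = primalObj ω g x := by
  choose a ha _ using fun i => mem_subdifferential_iff.1 (hsub i)
  have h1 : dualObj ω g y = ((∑ i, -(ω i * (inner ℝ (y i) x - a i)) : ℝ) : EReal) := by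
    rw [coe_real_sum]
    refine Finset.sum_congr rfl fun i _ => ?_
    rw [conjugate_eq_of_mem_subdifferential (hsub i) (ha i), ← EReal.coe_mul, EReal.coe_neg]
  have h2 : primalObj ω g x = ((∑ i, ω i * a i : ℝ) : EReal) := by
    rw [coe_real_sum]
    refine Finset.sum_congr rfl fun i _ => ?_
    rw [ha i, EReal.coe_mul]
  have h3 : inner ℝ (∑ i, ω i • y i) x = 0 := by
    rw [show ∑ i, ω i • y i = 0 from hy, inner_zero_left]
  simp only [sum_inner, inner_smul_left, conj_trivial] at h3
  rw [h1, h2, EReal.coe_eq_coe_iff, Finset.sum_neg_distrib]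
  simp only [mul_sub, Finset.sum_sub_distrib, h3]
  ring

/-- The optimality system is sufficient for optimality in both problems. -/
theorem optimal_of_subdifferential {ω : Fin k → ℝ} (hω : ∀ i, 0 < ω i) {g : Fin k → X → EReal}
    (hproper : ∀ i, IsProper (g i)) {x : X} {y : Fin k → X} (hy : y ∈ dualFeasible ω)
    (hsub : ∀ i, y i ∈ subdifferential (g i) x) :
    IsPrimalSolution ω g x ∧ IsDualSolution ω g y ∧ primalValue ω g = dualValue ω g := by
  have heq := dualObj_eq_primalObj hy hsub
  refine ⟨fun z => heq ▸ dualObj_le_primalObj hω hproper hy z,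
    ⟨hy, fun z hz => heq ▸ dualObj_le_primalObj hω hproper hz x⟩, le_antisymm ?_ ?_⟩
  · exact (iInf_le _ x).trans (heq ▸ le_iSup₂_of_le (f := fun z _ => dualObj ω g z) y hy le_rfl)
  · exact iSup₂_le fun z hz => le_iInf fun x' => dualObj_le_primalObj hω hproper hz x'

end Duality

/-! ### Convergence of Fejér monotone sequences -/

section Convergence

/-- Fejér monotone sequences with respect to a positive definite gauge converge as soon as the
cluster points belong to the target set. -/
theorem exists_tendsto_of_fejer {E : Type*} [NormedAddCommGroup E] [ProperSpace E] {w : ℕ → E}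
    {Z : Set E} (hZ : Z.Nonempty) {Q : E → ℝ} (hQ : Continuous Q) (hQ0 : Q 0 = 0) {c : ℝ}
    (hc : 0 < c) (hQc : ∀ a, c * ‖a‖ ^ 2 ≤ Q a)
    (hdesc : ∀ z ∈ Z, ∀ n, Q (w (n + 1) - z) + Q (w n - w (n + 1)) ≤ Q (w n - z))
    (hclust : ∀ z (φ : ℕ → ℕ), StrictMono φ → Tendsto (fun n => w (φ n)) atTop (𝓝 z) →
      Tendsto (fun n => w (φ n + 1)) atTop (𝓝 z) → z ∈ Z) :
    ∃ z ∈ Z, Tendsto w atTop (𝓝 z) := by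
  have hQnn : ∀ a, 0 ≤ Q a := fun a => (by positivity : 0 ≤ c * ‖a‖ ^ 2).trans (hQc a)
  have hanti : ∀ z ∈ Z, Antitone fun n => Q (w n - z) := fun z hz =>
    antitone_nat_of_succ_le fun n => by linarith [hdesc z hz n, hQnn (w n - w (n + 1))]
  have hlim : ∀ z ∈ Z, ∃ l, Tendsto (fun n => Q (w n - z)) atTop (𝓝 l) := fun z hz =>
    ⟨_, tendsto_atTop_ciInf (hanti z hz) ⟨0, by rintro _ ⟨n, rfl⟩; exact hQnn _⟩⟩
  have hnorm : ∀ u : ℕ → E, Tendsto (fun n => Q (u n)) atTop (𝓝 0) → Tendsto u atTop (𝓝 0) := by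
    intro u hu
    rw [tendsto_zero_iff_norm_tendsto_zero]
    have h1 : Tendsto (fun n => Real.sqrt (c⁻¹ * Q (u n))) atTop (𝓝 0) := by
      simpa [Function.comp_def] using (Real.continuous_sqrt.tendsto _).comp (hu.const_mul c⁻¹)
    refine squeeze_zero (fun n => norm_nonneg _) (fun n => Real.le_sqrt_of_sq_le ?_) h1
    rw [inv_mul_eq_div, le_div_iff₀ hc, mul_comm]
    exact hQc _
  obtain ⟨z₀, hz₀⟩ := hZ
  -- The increments are dominated by consecutive differences of the convergent sequence Q(w n - z₀).
  have hdiff : Tendsto (fun n => w n - w (n + 1)) atTop (𝓝 0) := by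
    obtain ⟨l, hl⟩ := hlim z₀ hz₀
    have h1 : Tendsto (fun n => Q (w n - z₀) - Q (w (n + 1) - z₀)) atTop (𝓝 0) := by
      simpa using hl.sub (hl.comp (tendsto_add_atTop_nat 1))
    exact hnorm _ (squeeze_zero (fun n => hQnn _) (fun n => by linarith [hdesc z₀ hz₀ n]) h1)
  have hbdd : ∀ n, w n ∈ Metric.closedBall z₀ (Real.sqrt (c⁻¹ * Q (w 0 - z₀))) := by
    intro n
    rw [Metric.mem_closedBall, dist_eq_norm]
    refine Real.le_sqrt_of_sq_le ?_
    rw [inv_mul_eq_div, le_div_iff₀ hc, mul_comm]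
    exact (hQc _).trans (hanti z₀ hz₀ (Nat.zero_le n))
  obtain ⟨z, -, φ, hφ, hz⟩ := tendsto_subseq_of_bounded Metric.isBounded_closedBall hbdd
  have hz' : Tendsto (fun n => w (φ n + 1)) atTop (𝓝 z) := by
    have h1 := hz.sub (hdiff.comp hφ.tendsto_atTop)
    simpa using h1
  have hzZ := hclust z φ hφ hz hz'
  refine ⟨z, hzZ, ?_⟩
  -- Since `z ∈ Z`, the whole sequence Q(w n - z) converges, and the subsequence identifies its
  -- limit as 0.
  obtain ⟨l, hl⟩ := hlim z hzZ
  have h1 : Tendsto (fun n => Q (w (φ n) - z)) atTop (𝓝 0) := by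
    have h2 : Tendsto (fun n => w (φ n) - z) atTop (𝓝 0) := by simpa using hz.sub_const z
    simpa [hQ0, Function.comp_def] using (hQ.tendsto 0).comp h2
  have hl0 : l = 0 := tendsto_nhds_unique (hl.comp hφ.tendsto_atTop) h1
  have h3 := hnorm _ (hl0 ▸ hl)
  simpa using h3.add_const z

end Convergence

/-! ### The metric of the two algorithms -/

section Algorithms

variable {X : Type*} [NormedAddCommGroup X] [InnerProductSpace ℝ X] {k : ℕ}

/-- Pairs `(x, y)` with `x` on the diagonal that solve the optimality system. -/
def saddleSet (ω : Fin k → ℝ) (g : Fin k → X → EReal) : Set ((Fin k → X) × (Fin k → X)) :=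
  {w | (∀ i j, w.1 i = w.1 j) ∧ w.2 ∈ dualFeasible ω ∧
    ∀ i, w.2 i ∈ subdifferential (g i) (w.1 i)}

/-- The quadratic form of the metric in which both algorithms are proximal point methods. -/
noncomputable def stepForm (ω : Fin k → ℝ) (σ τ s : ℝ) (w : (Fin k → X) × (Fin k → X)) : ℝ :=
  ∑ i, ω i * (τ⁻¹ * ‖w.1 i‖ ^ 2 + σ⁻¹ * ‖w.2 i‖ ^ 2 - 2 * s * inner ℝ (w.1 i) (w.2 i))

theorem continuous_stepForm (ω : Fin k → ℝ) (σ τ s : ℝ) :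
    Continuous (stepForm (X := X) ω σ τ s) := by
  unfold stepForm
  fun_prop

/-- With θ = √(στ) < 1, Young's inequality bounds the cross term by θ times the diagonal part,
leaving the fraction 1 - θ. -/
theorem exists_pos_forall_le_stepForm {ω : Fin k → ℝ} (hω : ∀ i, 0 < ω i) {σ τ s : ℝ}
    (hσ : 0 < σ) (hτ : 0 < τ) (hστ : σ * τ < 1) (hs : |s| ≤ 1) :
    ∃ c : ℝ, 0 < c ∧ ∀ w : (Fin k → X) × (Fin k → X), c * ‖w‖ ^ 2 ≤ stepForm ω σ τ s w := by
  set θ := Real.sqrt (σ * τ) with hθ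
  have hθ0 : 0 < θ := Real.sqrt_pos.2 (by positivity)
  have hθ2 : θ ^ 2 = σ * τ := Real.sq_sqrt (by positivity)
  have hθ1 : θ < 1 := by nlinarith
  set e := (1 - θ) * min τ⁻¹ σ⁻¹ with he
  have he0 : 0 < e := mul_pos (by linarith) (lt_min (inv_pos.2 hτ) (inv_pos.2 hσ))
  have hterm : ∀ a b : X, e * (‖a‖ ^ 2 + ‖b‖ ^ 2)
      ≤ τ⁻¹ * ‖a‖ ^ 2 + σ⁻¹ * ‖b‖ ^ 2 - 2 * s * inner ℝ a b := by
    intro a b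
    have h1 : s * inner ℝ a b ≤ ‖a‖ * ‖b‖ := by
      refine (le_abs_self _).trans ?_
      rw [abs_mul]
      have := abs_real_inner_le_norm a b
      nlinarith [abs_nonneg (inner ℝ a b : ℝ)]
    have h2 : 2 * (‖a‖ * ‖b‖) ≤ θ * (τ⁻¹ * ‖a‖ ^ 2 + σ⁻¹ * ‖b‖ ^ 2) := by
      have h3 : θ * τ⁻¹ * (θ * σ⁻¹) = 1 := by
        rw [show θ * τ⁻¹ * (θ * σ⁻¹) = θ ^ 2 * (τ⁻¹ * σ⁻¹) by ring, hθ2]; field_simp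
      have h4 : 0 < θ * τ⁻¹ := by positivity
      have h5 : θ * σ⁻¹ = (θ * τ⁻¹)⁻¹ := eq_inv_of_mul_eq_one_right h3
      have h6 : θ * (τ⁻¹ * ‖a‖ ^ 2 + σ⁻¹ * ‖b‖ ^ 2) - 2 * (‖a‖ * ‖b‖)
          = (θ * τ⁻¹)⁻¹ * (θ * τ⁻¹ * ‖a‖ - ‖b‖) ^ 2 := by
        rw [show θ * (τ⁻¹ * ‖a‖ ^ 2 + σ⁻¹ * ‖b‖ ^ 2)
          = θ * τ⁻¹ * ‖a‖ ^ 2 + θ * σ⁻¹ * ‖b‖ ^ 2 by ring, h5]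
        field_simp
        ring
      have h7 : 0 ≤ (θ * τ⁻¹)⁻¹ * (θ * τ⁻¹ * ‖a‖ - ‖b‖) ^ 2 := by positivity
      linarith
    have h8 : min τ⁻¹ σ⁻¹ * ‖a‖ ^ 2 ≤ τ⁻¹ * ‖a‖ ^ 2 :=
      mul_le_mul_of_nonneg_right (min_le_left _ _) (sq_nonneg _)
    have h9 : min τ⁻¹ σ⁻¹ * ‖b‖ ^ 2 ≤ σ⁻¹ * ‖b‖ ^ 2 :=
      mul_le_mul_of_nonneg_right (min_le_right _ _) (sq_nonneg _)
    rw [he]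
    nlinarith
  obtain ⟨m, hm0, hm⟩ : ∃ m : ℝ, 0 < m ∧ ∀ i, m ≤ ω i := by
    rcases isEmpty_or_nonempty (Fin k) with h | h
    · exact ⟨1, one_pos, fun i => (h.false i).elim⟩
    · obtain ⟨i₀, hi₀⟩ := Finite.exists_min ω
      exact ⟨ω i₀, hω i₀, hi₀⟩
  refine ⟨m * e, by positivity, fun w => ?_⟩
  -- The product carries the sup norm, so bounding each coordinate separately suffices.
  have hle : ∀ i, m * e * (‖w.1 i‖ ^ 2 + ‖w.2 i‖ ^ 2) ≤ stepForm ω σ τ s w := by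
    intro i
    have hnn : ∀ j, 0 ≤ ω j * (τ⁻¹ * ‖w.1 j‖ ^ 2 + σ⁻¹ * ‖w.2 j‖ ^ 2
        - 2 * s * inner ℝ (w.1 j) (w.2 j)) := fun j =>
      mul_nonneg (hω j).le ((by positivity : 0 ≤ e * (‖w.1 j‖ ^ 2 + ‖w.2 j‖ ^ 2)).trans
        (hterm _ _))
    refine le_trans ?_ (Finset.single_le_sum (fun j _ => hnn j) (Finset.mem_univ i))
    rw [mul_assoc]
    exact mul_le_mul (hm i) (hterm _ _) (by positivity) (hω i).le
  have hnn : 0 ≤ stepForm ω σ τ s w := by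
    rcases isEmpty_or_nonempty (Fin k) with h | ⟨⟨i⟩⟩
    · simp [stepForm]
    · exact (by positivity : 0 ≤ m * e * (‖w.1 i‖ ^ 2 + ‖w.2 i‖ ^ 2)).trans (hle i)
  have hme : 0 < m * e := by positivity
  have hw : ‖w‖ ≤ Real.sqrt ((m * e)⁻¹ * stepForm ω σ τ s w) := by
    have hcoord : ∀ i, ‖w.1 i‖ ^ 2 + ‖w.2 i‖ ^ 2 ≤ (m * e)⁻¹ * stepForm ω σ τ s w := by
      intro i
      rw [inv_mul_eq_div, le_div_iff₀ hme, mul_comm]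
      exact hle i
    rw [Prod.norm_def]
    refine max_le ?_ ?_ <;> refine (pi_norm_le_iff_of_nonneg (Real.sqrt_nonneg _)).2 fun i =>
      Real.le_sqrt_of_sq_le (le_trans ?_ (hcoord i))
    · linarith [sq_nonneg ‖w.2 i‖]
    · linarith [sq_nonneg ‖w.1 i‖]
  have h1 := pow_le_pow_left₀ (norm_nonneg _) hw 2
  rw [Real.sq_sqrt (by positivity), inv_mul_eq_div, le_div_iff₀ hme] at h1
  linarith

/-- The descent inequality of the proximal point method in the metric `stepForm`. -/
theorem stepForm_descent {ω : Fin k → ℝ} {σ τ s : ℝ}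
    {w w' z : (Fin k → X) × (Fin k → X)}
    (h : 0 ≤ ∑ i, ω i * (inner ℝ (τ⁻¹ • (w.1 i - w'.1 i) - s • (w.2 i - w'.2 i)) (w'.1 i - z.1 i)
      + inner ℝ (σ⁻¹ • (w.2 i - w'.2 i) - s • (w.1 i - w'.1 i)) (w'.2 i - z.2 i))) :
    stepForm ω σ τ s (w' - z) + stepForm ω σ τ s (w - w') ≤ stepForm ω σ τ s (w - z) := by
  -- Polarization of the quadratic form along w - z = (w - w') + (w' - z).
  have key : stepForm ω σ τ s (w - z) = stepForm ω σ τ s (w' - z) + stepForm ω σ τ s (w - w')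
      + 2 * ∑ i, ω i * (inner ℝ (τ⁻¹ • (w.1 i - w'.1 i) - s • (w.2 i - w'.2 i)) (w'.1 i - z.1 i)
      + inner ℝ (σ⁻¹ • (w.2 i - w'.2 i) - s • (w.1 i - w'.1 i)) (w'.2 i - z.2 i)) := by
    unfold stepForm
    rw [Finset.mul_sum, ← Finset.sum_add_distrib, ← Finset.sum_add_distrib]
    refine Finset.sum_congr rfl fun i _ => ?_
    simp only [Prod.fst_sub, Prod.snd_sub, Pi.sub_apply]
    have e1 : w.1 i - z.1 i = (w.1 i - w'.1 i) + (w'.1 i - z.1 i) := by abel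
    have e2 : w.2 i - z.2 i = (w.2 i - w'.2 i) + (w'.2 i - z.2 i) := by abel
    rw [e1, e2]
    generalize w.1 i - w'.1 i = a
    generalize w'.1 i - z.1 i = b
    generalize w.2 i - w'.2 i = p
    generalize w'.2 i - z.2 i = q
    simp only [← real_inner_self_eq_norm_sq, inner_add_left, inner_add_right, inner_sub_left,
      inner_smul_left, conj_trivial, real_inner_comm a b, real_inner_comm p q,
      real_inner_comm b p]
    ring
  linarith

end Algorithms

/-! ### Convergence of the two algorithms -/

section AlgorithmConvergence

variable {X : Type*} [NormedAddCommGroup X] [InnerProductSpace ℝ X] [FiniteDimensional ℝ X] {k : ℕ}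

theorem GeneratedByFirst.tendsto {ω : Fin k → ℝ} (hω : ∀ i, 0 < ω i) (hω_sum : ∑ i, ω i = 1)
    {g : Fin k → X → EReal} (hproper : ∀ i, IsProper (g i)) (hconvex : ∀ i, IsConvexFun (g i))
    (hlsc : ∀ i, LowerSemicontinuous (g i)) (hZ : (saddleSet ω g).Nonempty) {σ τ : ℝ}
    (hσ : 0 < σ) (hτ : 0 < τ) (hστ : σ * τ < 1) {x xbar : ℕ → X} {y : ℕ → Fin k → X}
    (h : GeneratedByFirst ω g σ τ x xbar y) :
    (∃ xstar, IsPrimalSolution ω g xstar ∧ Tendsto x atTop (𝓝 xstar)) ∧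
      (∃ ystar, IsDualSolution ω g ystar ∧ Tendsto y atTop (𝓝 ystar)) := by
  have : ProperSpace X := FiniteDimensional.proper ℝ X
  obtain ⟨c, hc, hQc⟩ := exists_pos_forall_le_stepForm (X := X) (s := 1) hω hσ hτ hστ (by simp)
  have hprox : ∀ n i, y (n + 2) i ∈
      subdifferential (g i) (σ⁻¹ • (y (n + 1) i - y (n + 2) i) + ((2 : ℝ) • x (n + 1) - x n)) := by
    intro n i
    have h1 := prox_conjugate_mem_subdifferential hσ (hproper i) (hconvex i) (hlsc i)
      (y (n + 1) i + σ • xbar (n + 1))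
    rw [← h.y_succ (n + 1) i, h.xbar_succ] at h1
    convert h1 using 1
    rw [add_sub_right_comm, smul_add, inv_smul_smul₀ hσ.ne']
  have hx : ∀ n, τ⁻¹ • (x n - x (n + 1)) = ∑ i, ω i • y (n + 1) i := by
    intro n
    rw [h.x_succ, sub_sub_cancel, inv_smul_smul₀ hτ.ne']
  obtain ⟨i₀⟩ : Nonempty (Fin k) := by
    by_contra hne
    rw [not_nonempty_iff] at hne
    simp at hω_sum
  obtain ⟨z, hz, hlim⟩ := exists_tendsto_of_fejer
    -- The index shift makes 2x^{n+1} - x^n, used for y^{n+2}, a function of two consecutive states.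
    (w := fun n => ((fun _ => x n, y (n + 1)) : (Fin k → X) × (Fin k → X))) hZ
    (continuous_stepForm ω σ τ 1) (by simp [stepForm]) hc hQc (by
      rintro ⟨a, b⟩ ⟨ha, hb, hab⟩ n
      apply stepForm_descent
      dsimp only at ha hb hab ⊢
      have hmono := fun i => mul_nonneg (hω i).le (subdifferential_monotone (hprox n i) (hab i))
      -- This is the gap between the monotonicity terms and the terms required for descent; it is
      -- paired with x^{n+1} - a, the same vector for all i, so it drops out of the weighted sum.
      have hzero : ∑ i, ω i • (τ⁻¹ • (x n - x (n + 1)) - y (n + 1) i + b i) = 0 := by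
        have hb' : ∑ i, ω i • b i = 0 := hb
        have hq := hx n
        generalize τ⁻¹ • (x n - x (n + 1)) = q at hq ⊢
        simp only [smul_add, smul_sub, Finset.sum_add_distrib, Finset.sum_sub_distrib]
        rw [hb', ← hq, ← Finset.sum_smul, hω_sum, one_smul, sub_self, add_zero]
      have hinner : ∑ i, ω i * inner ℝ (τ⁻¹ • (x n - x (n + 1)) - y (n + 1) i + b i)
          (x (n + 1) - a i₀) = 0 := by
        have h2 := congrArg (fun v => (inner ℝ v (x (n + 1) - a i₀) : ℝ)) hzero
        simpa only [sum_inner, inner_smul_left, conj_trivial, inner_zero_left] using h2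
      refine (Finset.sum_nonneg (s := Finset.univ) fun i _ => hmono i).trans_eq ?_
      rw [← add_zero (∑ i, _), ← hinner, ← Finset.sum_add_distrib]
      refine Finset.sum_congr rfl fun i _ => ?_
      rw [← mul_add, ha i i₀]
      congr 1
      set e := x (n + 1) - a i₀
      have h3 : σ⁻¹ • (y (n + 1) i - y (n + 2) i) + ((2 : ℝ) • x (n + 1) - x n) - a i₀
          = (σ⁻¹ • (y (n + 1) i - y (n + 2) i) - (1 : ℝ) • (x n - x (n + 1))) + e := by
        simp only [e]; module
      rw [h3, inner_add_right, real_inner_comm _ (y (n + 2) i - b i)]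
      simp only [inner_add_left, inner_sub_left, one_smul]
      ring) (by
      intro z φ hφ hz hz'
      obtain ⟨hz1, hz2⟩ := Prod.tendsto_iff _ _ |>.1 hz
      obtain ⟨hz1', hz2'⟩ := Prod.tendsto_iff _ _ |>.1 hz'
      dsimp only at hz1 hz2 hz1' hz2'
      rw [tendsto_pi_nhds] at hz1 hz2 hz1' hz2'
      refine ⟨fun i j => tendsto_nhds_unique (hz1 i) (hz1 j), ?_, fun i => ?_⟩
      · have h1 : Tendsto (fun n => ∑ i, ω i • y (φ n + 1) i) atTop (𝓝 (∑ i, ω i • z.2 i)) :=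
          tendsto_finsetSum _ fun i _ => (hz2 i).const_smul (ω i)
        have h2 : Tendsto (fun n => τ⁻¹ • (x (φ n) - x (φ n + 1))) atTop (𝓝 0) := by
          simpa using ((hz1 i₀).sub (hz1' i₀)).const_smul τ⁻¹
        simp only [hx] at h2
        exact tendsto_nhds_unique h1 h2
      · refine mem_subdifferential_of_tendsto (hproper i) (hlsc i) (fun n => hprox (φ n) i) ?_
          (hz2' i)
        have h1 := (((hz2 i).sub (hz2' i)).const_smul σ⁻¹).add
          (((hz1' i).const_smul (2 : ℝ)).sub (hz1 i))
        have h2 : σ⁻¹ • (z.2 i - z.2 i) + ((2 : ℝ) • z.1 i - z.1 i) = z.1 i := by module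
        rwa [h2] at h1)
  obtain ⟨hz1, hz2⟩ := Prod.tendsto_iff _ _ |>.1 hlim
  obtain ⟨hP, hD, -⟩ := optimal_of_subdifferential hω hproper hz.2.1
    (x := z.1 i₀) (fun i => hz.1 i i₀ ▸ hz.2.2 i)
  exact ⟨⟨_, hP, tendsto_pi_nhds.1 hz1 i₀⟩, ⟨_, hD, (tendsto_add_atTop_iff_nat 1).1 hz2⟩⟩

theorem GeneratedBySecond.tendsto {ω : Fin k → ℝ} (hω : ∀ i, 0 < ω i) (hω_sum : ∑ i, ω i = 1)
    {g : Fin k → X → EReal} (hproper : ∀ i, IsProper (g i)) (hconvex : ∀ i, IsConvexFun (g i))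
    (hlsc : ∀ i, LowerSemicontinuous (g i)) (hZ : (saddleSet ω g).Nonempty) {σ τ : ℝ}
    (hσ : 0 < σ) (hτ : 0 < τ) (hστ : σ * τ < 1) {x xbar y : ℕ → Fin k → X}
    (h : GeneratedBySecond ω g σ τ x xbar y) :
    (∀ i, ∃ xstar, IsPrimalSolution ω g xstar ∧ Tendsto (fun n => x n i) atTop (𝓝 xstar)) ∧
      (∃ ystar, IsDualSolution ω g ystar ∧ Tendsto y atTop (𝓝 ystar)) := by
  have : ProperSpace X := FiniteDimensional.proper ℝ X
  obtain ⟨c, hc, hQc⟩ := exists_pos_forall_le_stepForm (X := X) (s := -1) hω hσ hτ hστ (by simp)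
  have hprox : ∀ n i, τ⁻¹ • (x n i - x (n + 1) i) + y (n + 1) i ∈
      subdifferential (g i) (x (n + 1) i) := by
    intro n i
    have h1 := prox_mem_subdifferential hτ (hproper i) (hconvex i) (hlsc i)
      (x n i + τ • y (n + 1) i)
    rw [← h.x_succ n i] at h1
    convert h1 using 1
    rw [add_sub_right_comm, smul_add, inv_smul_smul₀ hτ.ne']
  -- The y-update subtracts weighted means, and the weights sum to 1: it projects onto the dual
  -- feasible subspace.
  have hfeas : ∀ n, ∑ i, ω i • y (n + 1) i = 0 := by
    intro n
    simp only [h.y_succ, smul_add, smul_sub, Finset.sum_add_distrib, Finset.sum_sub_distrib,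
      ← Finset.sum_smul, hω_sum, one_smul]
    have h1 : ∑ i, ω i • σ • xbar n i = σ • ∑ i, ω i • xbar n i := by
      rw [Finset.smul_sum]
      exact Finset.sum_congr rfl fun i _ => smul_comm _ _ _
    rw [h1]
    abel
  -- Optimality of that projection: the residual is diagonal, hence normal to the feasible subspace
  -- in the weighted inner product.
  have hdiag : ∀ n, ∃ d : X, ∀ i, σ⁻¹ • (y (n + 1) i - y (n + 2) i)
      + (x n i - (2 : ℝ) • x (n + 1) i) = d := by
    intro n
    refine ⟨σ⁻¹ • (∑ j, ω j • y (n + 1) j - σ • ∑ j, ω j • xbar (n + 1) j), fun i => ?_⟩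
    have h1 : y (n + 1) i - y (n + 2) i = σ • xbar (n + 1) i
        + (∑ j, ω j • y (n + 1) j - σ • ∑ j, ω j • xbar (n + 1) j) := by
      rw [h.y_succ (n + 1) i]; abel
    rw [h1, smul_add, inv_smul_smul₀ hσ.ne', h.xbar_succ]
    abel
  obtain ⟨i₀⟩ : Nonempty (Fin k) := by
    by_contra hne
    rw [not_nonempty_iff] at hne
    simp at hω_sum
  obtain ⟨z, hz, hlim⟩ := exists_tendsto_of_fejer
    (w := fun n => ((x n, y (n + 1)) : (Fin k → X) × (Fin k → X))) hZ
    (continuous_stepForm ω σ τ (-1)) (by simp [stepForm]) hc hQc (by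
      rintro ⟨a, b⟩ ⟨ha, hb, hab⟩ n
      apply stepForm_descent
      dsimp only at ha hb hab ⊢
      obtain ⟨d, hd⟩ := hdiag n
      have hmono := fun i => mul_nonneg (hω i).le (subdifferential_monotone (hprox n i) (hab i))
      have hzero : ∑ i, ω i • (y (n + 2) i - b i) = 0 := by
        have hb' : ∑ i, ω i • b i = 0 := hb
        simp only [smul_sub, Finset.sum_sub_distrib]
        rw [hb', hfeas (n + 1), sub_zero]
      have hinner : ∑ i, ω i * inner ℝ (y (n + 2) i - b i) (d + a i₀) = 0 := by
        have h2 := congrArg (fun v => (inner ℝ v (d + a i₀) : ℝ)) hzero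
        simpa only [sum_inner, inner_smul_left, conj_trivial, inner_zero_left] using h2
      refine (Finset.sum_nonneg (s := Finset.univ) fun i _ => hmono i).trans_eq ?_
      rw [← add_zero (∑ i, _), ← hinner, ← Finset.sum_add_distrib]
      refine Finset.sum_congr rfl fun i _ => ?_
      rw [← mul_add, ← ha i i₀, ← hd i]
      congr 1
      set e := x (n + 1) i - a i
      have h3 : σ⁻¹ • (y (n + 1) i - y (n + 2) i) + (x n i - (2 : ℝ) • x (n + 1) i) + a i
          = (σ⁻¹ • (y (n + 1) i - y (n + 2) i) - (-1 : ℝ) • (x n i - x (n + 1) i)) - e := by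
        simp only [e]; module
      have h4 : τ⁻¹ • (x n i - x (n + 1) i) + y (n + 1) i - b i
          = (τ⁻¹ • (x n i - x (n + 1) i) - (-1 : ℝ) • (y (n + 1) i - y (n + 2) i))
            + (y (n + 2) i - b i) := by module
      have h5 : ∀ p q r t : X, (inner ℝ (p + q) r + inner ℝ q (t - r) : ℝ)
          = inner ℝ p r + inner ℝ t q := by
        intro p q r t
        rw [inner_sub_right, inner_add_left, real_inner_comm t q]
        ring
      rw [h3, h4]
      exact h5 _ _ _ _) (by
      intro z φ hφ hz hz'
      obtain ⟨hz1, hz2⟩ := Prod.tendsto_iff _ _ |>.1 hz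
      obtain ⟨hz1', hz2'⟩ := Prod.tendsto_iff _ _ |>.1 hz'
      dsimp only at hz1 hz2 hz1' hz2'
      rw [tendsto_pi_nhds] at hz1 hz2 hz1' hz2'
      refine ⟨fun i j => ?_, ?_, fun i => ?_⟩
      -- The diagonal residual tends to `-z.1 i` in coordinate i, so all these limits agree.
      · have h1 : ∀ i, Tendsto (fun n => σ⁻¹ • (y (φ n + 1) i - y (φ n + 2) i)
            + (x (φ n) i - (2 : ℝ) • x (φ n + 1) i)) atTop (𝓝 (-z.1 i)) := by
          intro i
          have h1 := (((hz2 i).sub (hz2' i)).const_smul σ⁻¹).add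
            ((hz1 i).sub ((hz1' i).const_smul (2 : ℝ)))
          have h2 : σ⁻¹ • (z.2 i - z.2 i) + (z.1 i - (2 : ℝ) • z.1 i) = -z.1 i := by module
          rwa [h2] at h1
        refine neg_injective (tendsto_nhds_unique (h1 i) ((h1 j).congr fun n => ?_))
        obtain ⟨d, hd⟩ := hdiag (φ n)
        rw [hd i, hd j]
      · have h1 : Tendsto (fun n => ∑ i, ω i • y (φ n + 1) i) atTop (𝓝 (∑ i, ω i • z.2 i)) :=
          tendsto_finsetSum _ fun i _ => (hz2 i).const_smul (ω i)
        simp only [hfeas] at h1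
        exact tendsto_nhds_unique h1 tendsto_const_nhds
      · refine mem_subdifferential_of_tendsto (hproper i) (hlsc i) (fun n => hprox (φ n) i)
          (hz1' i) ?_
        have h1 := (((hz1 i).sub (hz1' i)).const_smul τ⁻¹).add (hz2 i)
        simpa using h1)
  obtain ⟨hz1, hz2⟩ := Prod.tendsto_iff _ _ |>.1 hlim
  have hopt := fun j => optimal_of_subdifferential hω hproper hz.2.1
    (x := z.1 j) (fun i => hz.1 i j ▸ hz.2.2 i)
  exact ⟨fun i => ⟨_, (hopt i).1, tendsto_pi_nhds.1 hz1 i⟩,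
    ⟨_, (hopt i₀).2.1, (tendsto_add_atTop_iff_nat 1).1 hz2⟩⟩

end AlgorithmConvergence

/-! ### Qualification conditions and necessity of the optimality system -/

section Qualification

variable {X : Type*} [NormedAddCommGroup X] [InnerProductSpace ℝ X] {k : ℕ}

/-- A decreasing sequence of nonempty bounded closed convex sets in a Hilbert space has a common
point. -/
theorem nonempty_iInter_of_antitone_convex [CompleteSpace X] {A : ℕ → Set X} (hanti : Antitone A)
    (hne : ∀ n, (A n).Nonempty) (hclosed : ∀ n, IsClosed (A n)) (hconv : ∀ n, Convex ℝ (A n))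
    {R : ℝ} (hR : ∀ x ∈ A 0, ‖x‖ ≤ R) : (⋂ n, A n).Nonempty := by
  -- The minimal-norm points have increasing bounded norms; midpoints stay in the larger set, so the
  -- parallelogram law makes the sequence Cauchy.
  have hex : ∀ n, ∃ v ∈ A n, ∀ w ∈ A n, ‖v‖ ≤ ‖w‖ := by
    intro n
    obtain ⟨v, hv, hmin⟩ :=
      exists_norm_eq_iInf_of_complete_convex (hne n) (hclosed n).isComplete (hconv n) 0
    refine ⟨v, hv, fun w hw => ?_⟩
    rw [zero_sub, norm_neg] at hmin
    rw [hmin]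
    have h1 := ciInf_le (f := fun w : A n => ‖(0 : X) - w‖)
      ⟨0, by rintro _ ⟨w, rfl⟩; exact norm_nonneg _⟩ ⟨w, hw⟩
    simpa using h1
  choose v hv hmin using hex
  have hmono : Monotone fun n => ‖v n‖ := fun m l hml => hmin m _ (hanti hml (hv l))
  have hbdd : BddAbove (Set.range fun n => ‖v n‖) :=
    ⟨R, by rintro _ ⟨n, rfl⟩; exact hR _ (hanti (Nat.zero_le n) (hv n))⟩
  set d := ⨆ n, ‖v n‖
  have hd : Tendsto (fun n => ‖v n‖) atTop (𝓝 d) := tendsto_atTop_ciSup hmono hbdd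
  have hcauchy : CauchySeq v := by
    refine cauchySeq_of_le_tendsto_0' (fun n => Real.sqrt (2 * (d ^ 2 - ‖v n‖ ^ 2))) ?_ ?_
    · intro m l hml
      rw [dist_eq_norm]
      refine Real.le_sqrt_of_sq_le ?_
      have h1 : (1 / 2 : ℝ) • v m + (1 / 2 : ℝ) • v l ∈ A m :=
        hconv m (hv m) (hanti hml (hv l)) (by norm_num) (by norm_num) (by norm_num)
      have h2 := hmin m _ h1
      rw [← smul_add, norm_smul, Real.norm_of_nonneg (by norm_num)] at h2
      have h3 := parallelogram_law_with_norm ℝ (v m) (v l)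
      have h4 : ‖v l‖ ≤ d := le_ciSup hbdd l
      nlinarith [norm_nonneg (v m), norm_nonneg (v l), norm_nonneg (v m + v l)]
    · have h1 : Continuous fun a : ℝ => Real.sqrt (2 * (d ^ 2 - a ^ 2)) := by fun_prop
      simpa [Function.comp_def] using (h1.tendsto d).comp hd
  obtain ⟨x, hx⟩ := cauchySeq_tendsto_of_complete hcauchy
  refine ⟨x, Set.mem_iInter.2 fun n => (hclosed n).mem_of_tendsto hx ?_⟩
  filter_upwards [eventually_ge_atTop n] with m hm using hanti hm (hv m)

/-- The projection of a closed convex set along a bounded Hilbert space factor is closed. -/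
theorem isClosed_projection_of_convex [CompleteSpace X] {E : Type*} [NormedAddCommGroup E]
    [NormedSpace ℝ E] {K : Set (X × E)} (hK : IsClosed K) (hconv : Convex ℝ K) (R : ℝ) :
    IsClosed {z : E | ∃ x : X, ‖x‖ ≤ R ∧ (x, z) ∈ K} := by
  rw [← closure_subset_iff_isClosed]
  intro z hz
  -- Approximate fibres over `z`; a common point of their closures lies in the exact fibre because
  -- `K` is closed.
  let B : ℕ → Set X := fun n => {x | ‖x‖ ≤ R ∧ ∃ z' : E, ‖z' - z‖ ≤ 1 / (n + 1) ∧ (x, z') ∈ K}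
  have hBR : ∀ n, closure (B n) ⊆ Metric.closedBall 0 R := fun n =>
    closure_minimal (fun x hx => by simpa using hx.1) Metric.isClosed_closedBall
  obtain ⟨x, hx⟩ := nonempty_iInter_of_antitone_convex (A := fun n => closure (B n)) (R := R)
    (by
      intro m n hmn
      refine closure_mono fun x hx => ⟨hx.1, ?_⟩
      obtain ⟨z', h1, h2⟩ := hx.2
      exact ⟨z', h1.trans (one_div_le_one_div_of_le (by positivity) (by
        have : (m : ℝ) ≤ n := by exact_mod_cast hmn
        linarith)), h2⟩)
    (by
      intro n
      obtain ⟨z', ⟨x, hx, hxz⟩, hzz⟩ := Metric.mem_closure_iff.1 hz (1 / (n + 1)) (by positivity)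
      exact ⟨x, subset_closure ⟨hx, z', by rw [← dist_eq_norm, dist_comm]; exact hzz.le, hxz⟩⟩)
    (fun n => isClosed_closure)
    (by
      intro n
      refine Convex.closure ?_
      rintro x ⟨hx, z₁, hz₁, hxz₁⟩ y ⟨hy, z₂, hz₂, hyz₂⟩ s t hs ht hst
      refine ⟨?_, s • z₁ + t • z₂, ?_, hconv hxz₁ hyz₂ hs ht hst⟩
      · have := convex_closedBall (0 : X) R (x := x) (by simpa using hx) (y := y)
          (by simpa using hy) hs ht hst
        simpa using this
      · have := convex_closedBall z (1 / ((n : ℝ) + 1)) (x := z₁)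
          (by simpa [dist_eq_norm] using hz₁) (y := z₂) (by simpa [dist_eq_norm] using hz₂)
          hs ht hst
        simpa [dist_eq_norm] using this)
    (fun x hx => by simpa using hBR 0 hx)
  rw [Set.mem_iInter] at hx
  refine ⟨x, by simpa using hBR 0 (hx 0), ?_⟩
  rw [← hK.closure_eq, Metric.mem_closure_iff]
  intro ε hε
  obtain ⟨n, hn⟩ := exists_nat_one_div_lt hε
  obtain ⟨x', ⟨-, z', hz', hxz'⟩, hd⟩ := Metric.mem_closure_iff.1 (hx n) ε hε
  refine ⟨(x', z'), hxz', ?_⟩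
  rw [Prod.dist_eq]
  refine max_lt hd ?_
  rw [dist_comm, dist_eq_norm]
  exact hz'.trans_lt hn

/-- A convex epigraph-like set that is bounded above near `0` has a continuous linear support. -/
theorem exists_linear_support {E : Type*} [NormedAddCommGroup E] [NormedSpace ℝ E]
    {P : Set (E × ℝ)} (hP : Convex ℝ P) {p r M : ℝ} (hr : 0 < r)
    (hM : ∀ z : E, ‖z‖ < r → ∀ t, M ≤ t → (z, t) ∈ P) (hp : ∀ t, ((0 : E), t) ∈ P → p ≤ t) :
    ∃ ℓ : E →L[ℝ] ℝ, ∀ z t, (z, t) ∈ P → p + ℓ z ≤ t := by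
  have hint : ∀ t, M < t → ((0 : E), t) ∈ interior P := by
    intro t ht
    refine mem_interior.2 ⟨Metric.ball 0 r ×ˢ Set.Ioi M, ?_, Metric.isOpen_ball.prod isOpen_Ioi,
      ⟨Metric.mem_ball_self hr, ht⟩⟩
    rintro ⟨z, s⟩ ⟨hz, hs⟩
    exact hM z (by simpa using hz) s (le_of_lt hs)
  have hnot : ((0 : E), p) ∉ interior P := by
    intro h
    have h1 : Tendsto (fun t : ℝ => ((0 : E), t)) (𝓝[<] p) (𝓝 (0, p)) :=
      ((Continuous.prodMk_right (0 : E)).tendsto p).mono_left nhdsWithin_le_nhds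
    obtain ⟨t, ht1, ht2⟩ := ((h1.eventually (mem_interior_iff_mem_nhds.1 h)).and
      self_mem_nhdsWithin).exists
    exact absurd (hp t ht1) (not_le.2 ht2)
  obtain ⟨f, hf⟩ := geometric_hahn_banach_open_point hP.interior isOpen_interior hnot
  have hfP : ∀ a ∈ P, f a ≤ f (0, p) := by
    intro a ha
    apply closure_minimal (fun x hx => le_of_lt (hf x hx)) <| isClosed_Iic.preimage f.continuous
    rw [hP.closure_interior_eq_closure_of_nonempty_interior ⟨_, hint (M + 1) (by linarith)⟩]
    exact subset_closure ha
  have hsplit : ∀ (x : E) (t : ℝ), f (x, t) = f (x, 0) + t * f (0, 1) := by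
    intro x t
    have h1 : ((x, t) : E × ℝ) = (x, 0) + t • (0, 1) := by simp
    rw [h1, map_add, map_smul, smul_eq_mul]
  set β := f (0, 1)
  have h0 : f ((0 : E), (0 : ℝ)) = 0 := map_zero f
  -- The hyperplane is not vertical, because points high above 0 are interior to `P`.
  have hβ : β < 0 := by
    have h1 := hf _ (hint (max M p + 1) (by linarith [le_max_left M p]))
    rw [hsplit 0 (max M p + 1), hsplit 0 p] at h1
    nlinarith [le_max_right M p]
  refine ⟨(-β⁻¹) • f.comp (ContinuousLinearMap.inl ℝ E ℝ), fun z t hzt => ?_⟩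
  have h1 := hfP _ hzt
  rw [hsplit z t, hsplit 0 p, h0, zero_add] at h1
  have h2 : ((-β⁻¹) • f.comp (ContinuousLinearMap.inl ℝ E ℝ)) z = -β⁻¹ * f (z, 0) := rfl
  rw [h2]
  have h3 : -β⁻¹ * (f (z, 0) + t * β) ≤ -β⁻¹ * (p * β) :=
    mul_le_mul_of_nonneg_left h1 (neg_nonneg.2 (inv_nonpos.2 hβ.le))
  have h4 : -β⁻¹ * (f (z, 0) + t * β) = -β⁻¹ * f (z, 0) - t := by
    field_simp [hβ.ne]
    ring
  have h5 : -β⁻¹ * (p * β) = -p := by field_simp [hβ.ne]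
  linarith

theorem QC1.qc2 {E : Type*} [NormedAddCommGroup E] {g : Fin k → E → EReal} (h : QC1 g) : QC2 g := by
  obtain ⟨x', hx'⟩ := h
  refine mem_interior_iff_mem_nhds.2 ?_
  have h1 : ∀ᶠ z : Fin k → E in 𝓝 0, ∀ i, g i (x' + z i) < ⊤ := by
    rw [eventually_all]
    intro i
    have h2 : Tendsto (fun z : Fin k → E => x' + z i) (𝓝 0) (𝓝 x') := by
      have h3 : Continuous fun z : Fin k → E => x' + z i := by fun_prop
      simpa using h3.tendsto 0
    exact h2.eventually ((hx' i).2.eventually_lt_const (hx' i).1)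
  filter_upwards [h1] with z hz
  exact ⟨fun i => x' + z i, hz, x', by ext i; simp⟩

theorem QC2.qc3 {g : Fin k → X → EReal} (h : QC2 g) : QC3 g := by
  refine ⟨interior_subset h, ⊤, isClosed_univ, ?_⟩
  symm
  rw [Submodule.top_coe, Set.eq_univ_iff_forall]
  intro z
  have h1 : Tendsto (fun t : ℝ => t • z) (𝓝[>] 0) (𝓝 0) := by
    have h2 : Continuous fun t : ℝ => t • z := by fun_prop
    simpa using (h2.tendsto 0).mono_left nhdsWithin_le_nhds
  obtain ⟨t, ht1, ht2⟩ := ((h1.eventually (mem_interior_iff_mem_nhds.1 h)).and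
    self_mem_nhdsWithin).exists
  have ht0 : (0 : ℝ) < t := ht2
  exact ⟨t⁻¹, inv_pos.2 ht0, t • z, ht1, by rw [sub_zero, inv_smul_smul₀ ht0.ne']⟩

/-- Perturbations for which the shifted functions are bounded by `N` at a point of norm at most
`N`. -/
def boundedPerturbations (g : Fin k → X → EReal) (N : ℝ) : Set (Fin k → X) :=
  {z | ∃ x : X, ‖x‖ ≤ N ∧ ∀ i, g i (x + z i) ≤ (N : EReal)}

theorem boundedPerturbations_mono {E : Type*} [NormedAddCommGroup E] {g : Fin k → E → EReal} :
    Monotone (boundedPerturbations g) := by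
  rintro N M h z ⟨x, hx, hxz⟩
  exact ⟨x, hx.trans h, fun i => (hxz i).trans (EReal.coe_le_coe_iff.2 h)⟩

theorem convex_shift_sublevel {g : Fin k → X → EReal} (hconvex : ∀ i, IsConvexFun (g i)) (N : ℝ) :
    Convex ℝ {p : X × (Fin k → X) | ∀ i, g i (p.1 + p.2 i) ≤ (N : EReal)} := by
  rintro ⟨x, z⟩ hx ⟨y, w⟩ hy s t hs ht hst i
  have h1 := (hconvex i).le_combo (hx i) (hy i) hs ht hst
  rw [← add_mul, hst, one_mul] at h1
  convert h1 using 2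
  simp only [Prod.smul_mk, Prod.mk_add_mk, Pi.add_apply, Pi.smul_apply]
  module

theorem isClosed_boundedPerturbations [CompleteSpace X] {g : Fin k → X → EReal}
    (hconvex : ∀ i, IsConvexFun (g i)) (hlsc : ∀ i, LowerSemicontinuous (g i)) (N : ℝ) :
    IsClosed (boundedPerturbations g N) := by
  refine isClosed_projection_of_convex (K := {p : X × (Fin k → X) |
    ∀ i, g i (p.1 + p.2 i) ≤ (N : EReal)}) ?_ (convex_shift_sublevel hconvex N) N
  rw [Set.ofPred_forall]
  refine isClosed_iInter fun i => ?_
  have h1 : Continuous fun p : X × (Fin k → X) => p.1 + p.2 i := by fun_prop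
  exact ((hlsc i).isClosed_preimage (N : EReal)).preimage h1

theorem convex_boundedPerturbations {g : Fin k → X → EReal}
    (hconvex : ∀ i, IsConvexFun (g i)) (N : ℝ) : Convex ℝ (boundedPerturbations g N) := by
  rintro z ⟨x, hx, hxz⟩ w ⟨y, hy, hyw⟩ s t hs ht hst
  refine ⟨s • x + t • y, ?_, convex_shift_sublevel hconvex N (x := (x, z)) hxz
    (y := (y, w)) hyw hs ht hst⟩
  have := convex_closedBall (0 : X) N (x := x) (by simpa using hx) (y := y)
    (by simpa using hy) hs ht hst
  simpa using this

theorem exists_mem_boundedPerturbations {E : Type*} [NormedAddCommGroup E] {g : Fin k → E → EReal} (hproper : ∀ i, IsProper (g i))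
    {z : Fin k → E} (hz : z ∈ domDiff g) : ∃ N : ℝ, z ∈ boundedPerturbations g N := by
  obtain ⟨d, hd, x, rfl⟩ := hz
  choose a ha using fun i => (hproper i).exists_real (hd i)
  obtain ⟨M, hM⟩ := (Set.finite_range a).bddAbove
  refine ⟨max ‖x‖ M, x, le_max_left _ _, fun i => ?_⟩
  rw [add_sub_cancel, ha i, EReal.coe_le_coe_iff]
  exact (hM ⟨i, rfl⟩).trans (le_max_right _ _)

theorem baireSpace_of_complete (E : Type*) [NormedAddCommGroup E] [CompleteSpace E] :
    BaireSpace E :=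
  inferInstance

/-- Under the strong quasi-relative interior condition, a neighbourhood of `0` in the span of the
domain consists of uniformly bounded perturbations. -/
theorem exists_ball_subset_boundedPerturbations [CompleteSpace X] {g : Fin k → X → EReal}
    (hproper : ∀ i, IsProper (g i)) (hconvex : ∀ i, IsConvexFun (g i))
    (hlsc : ∀ i, LowerSemicontinuous (g i)) (h0 : (0 : Fin k → X) ∈ domDiff g)
    {S : Submodule ℝ (Fin k → X)} (hS : IsClosed (S : Set (Fin k → X)))
    (hcone : (S : Set (Fin k → X)) = {z | ∃ t : ℝ, 0 < t ∧ ∃ c ∈ domDiff g, z = t • (c - 0)}) :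
    ∃ r : ℝ, 0 < r ∧ ∃ N : ℝ, ∀ z ∈ S, ‖z‖ < r → z ∈ boundedPerturbations g N := by
  have : CompleteSpace S := hS.completeSpace_coe
  have : BaireSpace S := baireSpace_of_complete S
  have hmem : ∀ z ∈ S, ∃ t : ℝ, 0 < t ∧ ∃ c ∈ domDiff g, z = t • c := by
    intro z hz
    have h1 : z ∈ (S : Set (Fin k → X)) := hz
    rw [hcone] at h1
    simpa using h1
  obtain ⟨N₀, hN₀⟩ := exists_mem_boundedPerturbations hproper h0
  -- Baire on S: if s = t • c and n + 1 ≥ t, then s/(n + 1) is a convex combination of c and 0.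
  obtain ⟨n, s₀, hs₀⟩ := nonempty_interior_of_iUnion_of_closed
    (f := fun n : ℕ => {s : S | ((n + 1 : ℝ))⁻¹ • (s : Fin k → X) ∈ boundedPerturbations g (n + 1)})
    (fun n => (isClosed_boundedPerturbations hconvex hlsc _).preimage (by fun_prop)) (by
      rw [Set.eq_univ_iff_forall]
      intro s
      obtain ⟨t, ht, c, hc, hsc⟩ := hmem s s.2
      obtain ⟨N, hN⟩ := exists_mem_boundedPerturbations hproper hc
      obtain ⟨n, hn⟩ := exists_nat_ge (max t (max N₀ N))
      have hn1 : t ≤ n + 1 := by linarith [le_max_left t (max N₀ N)]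
      have hn2 : N₀ ≤ n + 1 := by
        linarith [le_max_right t (max N₀ N), le_max_left N₀ N]
      have hn3 : N ≤ n + 1 := by
        linarith [le_max_right t (max N₀ N), le_max_right N₀ N]
      have hn0 : (0 : ℝ) < n + 1 := by positivity
      refine Set.mem_iUnion.2 ⟨n, ?_⟩
      have h1 := convex_boundedPerturbations hconvex ((n : ℝ) + 1)
        (boundedPerturbations_mono hn3 hN) (boundedPerturbations_mono hn2 hN₀)
        (a := (n + 1 : ℝ)⁻¹ * t) (b := 1 - (n + 1 : ℝ)⁻¹ * t) (by positivity)
        (by rw [sub_nonneg, inv_mul_eq_div, div_le_one hn0]; exact hn1) (by ring)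
      rw [smul_zero, add_zero, mul_smul, ← hsc] at h1
      exact h1)
  obtain ⟨ρ, hρ, hball⟩ := Metric.mem_nhds_iff.1 (mem_interior_iff_mem_nhds.1 hs₀)
  -- Recentring at 0: averaging α(s₀ + b) with c, where t • c = -s₀, using weights 1/q and αt/q
  -- cancels `s₀` and leaves (α/q)b.
  obtain ⟨t, ht, c, hc, hsc⟩ := hmem (-s₀ : S) (-s₀).2
  obtain ⟨N, hN⟩ := exists_mem_boundedPerturbations hproper hc
  set α : ℝ := (n + 1 : ℝ)⁻¹ with hα
  have hα0 : 0 < α := by positivity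
  set q : ℝ := 1 + α * t with hq
  have hq0 : 0 < q := by positivity
  refine ⟨α / q * ρ, by positivity, max (n + 1) N, fun z hz hzr => ?_⟩
  set b : S := (q / α) • ⟨z, hz⟩ with hb
  have hbρ : ‖b‖ < ρ := by
    rw [hb, norm_smul, Real.norm_of_nonneg (by positivity), Submodule.coe_norm]
    calc q / α * ‖z‖ < q / α * (α / q * ρ) := mul_lt_mul_of_pos_left hzr (by positivity)
      _ = ρ := by field_simp
  have h1 : α • ((s₀ + b : S) : Fin k → X) ∈ boundedPerturbations g (n + 1) := by
    have : s₀ + b ∈ Metric.ball s₀ ρ := by simpa [dist_eq_norm] using hbρ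
    exact hball this
  have h2 := convex_boundedPerturbations hconvex (max ((n : ℝ) + 1) N)
    (boundedPerturbations_mono (le_max_left _ _) h1)
    (boundedPerturbations_mono (le_max_right _ _) hN) (a := 1 / q) (b := α * t / q)
    (by positivity) (by positivity) (by rw [← add_div, ← hq, div_self hq0.ne'])
  have h3 : (1 / q) • α • ((s₀ + b : S) : Fin k → X) + (α * t / q) • c = z := by
    have h4 : (α * t / q) • c = (α / q) • t • c := by rw [smul_smul]; congr 1; ring
    have h5 : ((b : S) : Fin k → X) = (q / α) • z := rfl
    have h6 : α / q * (q / α) = 1 := by field_simp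
    rw [h4, ← hsc, Submodule.coe_add, Submodule.coe_neg, h5, smul_smul, smul_neg, smul_add,
      smul_smul, one_div_mul_eq_div, h6, one_smul]
    abel
  rwa [h3] at h2

theorem primalObj_lt_top_iff {E : Type*} {ω : Fin k → ℝ} (hω : ∀ i, 0 < ω i) {g : Fin k → E → EReal}
    (hproper : ∀ i, IsProper (g i)) {x : E} : primalObj ω g x < ⊤ ↔ ∀ i, g i x < ⊤ := by
  -- Needed because ⊤ + ⊥ = ⊥ in `EReal`: a single infinite term forces ⊤ only if no partial sum is
  -- ⊥.
  have hbot : ∀ s : Finset (Fin k), ∑ i ∈ s, (ω i : EReal) * g i x ≠ ⊥ := by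
    intro s
    induction s using Finset.cons_induction with
    | empty => simp
    | cons a s ha ih =>
      rw [Finset.sum_cons]
      refine (EReal.bot_lt_add_iff.2 ⟨?_, bot_lt_iff_ne_bot.2 ih⟩).ne'
      have hb := (hproper a).2 x
      rcases eq_or_ne (g a x) ⊤ with h | h
      · rw [h, EReal.coe_mul_top_of_pos (hω a)]; exact bot_lt_top
      · obtain ⟨r, hr⟩ := (hproper a).exists_real (lt_top_iff_ne_top.2 h)
        rw [hr, ← EReal.coe_mul]; exact EReal.bot_lt_coe _
  constructor
  · intro h i
    by_contra hi
    rw [not_lt_top_iff] at hi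
    rw [primalObj, ← Finset.add_sum_erase _ _ (Finset.mem_univ i), hi,
      EReal.coe_mul_top_of_pos (hω i), EReal.top_add_of_ne_bot (hbot _)] at h
    exact lt_irrefl _ h
  · intro h
    choose a ha using fun i => (hproper i).exists_real (h i)
    have h1 : primalObj ω g x = ((∑ i, ω i * a i : ℝ) : EReal) := by
      rw [coe_real_sum]
      exact Finset.sum_congr rfl fun i _ => by rw [ha i, EReal.coe_mul]
    rw [h1]
    exact EReal.coe_lt_top _

theorem primalObj_le_coe {E : Type*} {ω : Fin k → ℝ} (hω : ∀ i, 0 < ω i) {g : Fin k → E → EReal} {x : E}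
    {a : Fin k → ℝ} (ha : ∀ i, g i x ≤ a i) :
    primalObj ω g x ≤ ((∑ i, ω i * a i : ℝ) : EReal) := by
  rw [coe_real_sum]
  refine Finset.sum_le_sum fun i _ => ?_
  rw [EReal.coe_mul]
  exact mul_le_mul_of_nonneg_left (ha i) (EReal.coe_nonneg.2 (hω i).le)

/-- The optimality system is necessary under the strong quasi-relative interior condition. -/
theorem exists_subdifferential_of_qc3 [CompleteSpace X] {ω : Fin k → ℝ} (hω : ∀ i, 0 < ω i)
    (hω_sum : ∑ i, ω i = 1) {g : Fin k → X → EReal} (hproper : ∀ i, IsProper (g i))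
    (hconvex : ∀ i, IsConvexFun (g i)) (hlsc : ∀ i, LowerSemicontinuous (g i)) {xhat : X}
    (hxhat : IsPrimalSolution ω g xhat) (hqc : QC3 g) :
    ∃ y ∈ dualFeasible ω, ∀ i, y i ∈ subdifferential (g i) xhat := by
  obtain ⟨h0, S, hS, hcone⟩ := hqc
  have hfin : ∀ i, g i xhat < ⊤ := by
    obtain ⟨d, hd, x, hdx⟩ := h0
    refine (primalObj_lt_top_iff hω hproper).1
      ((hxhat x).trans_lt ((primalObj_lt_top_iff hω hproper).2 fun i => ?_))
    have h1 : d i = x := by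
      have := congrFun hdx i
      exact (sub_eq_zero.1 this.symm)
    exact h1 ▸ hd i
  choose p hp using fun i => (hproper i).exists_real (hfin i)
  have hobj : primalObj ω g xhat = ((∑ i, ω i * p i : ℝ) : EReal) := by
    rw [coe_real_sum]
    exact Finset.sum_congr rfl fun i _ => by rw [hp i, EReal.coe_mul]
  obtain ⟨r, hr, N, hN⟩ :=
    exists_ball_subset_boundedPerturbations hproper hconvex hlsc h0 hS hcone
  -- `P` plays the role of the epigraph of the perturbation function on S; real bounds `a i` avoid
  -- taking the infimum.
  obtain ⟨ℓ, hℓ⟩ := exists_linear_support (E := S) (p := ∑ i, ω i * p i) (M := N)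
    (P := {q : S × ℝ | ∃ (x : X) (a : Fin k → ℝ),
      (∀ i, g i (x + (q.1 : Fin k → X) i) ≤ (a i : EReal)) ∧ ∑ i, ω i * a i ≤ q.2}) (by
      rintro ⟨z, s⟩ ⟨x, a, hxa, has⟩ ⟨w, t⟩ ⟨x', a', hxa', hat⟩ α β hα hβ hαβ
      refine ⟨α • x + β • x', fun i => α * a i + β * a' i, fun i => ?_, ?_⟩
      · have h1 := (hconvex i).le_combo (hxa i) (hxa' i) hα hβ hαβ
        convert h1 using 2
        simp only [Prod.smul_mk, Prod.mk_add_mk, Submodule.coe_add, Submodule.coe_smul,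
          Pi.add_apply, Pi.smul_apply]
        module
      · have h1 := add_le_add (mul_le_mul_of_nonneg_left has hα)
          (mul_le_mul_of_nonneg_left hat hβ)
        refine le_trans (le_of_eq ?_) h1
        rw [Finset.mul_sum, Finset.mul_sum, ← Finset.sum_add_distrib]
        exact Finset.sum_congr rfl fun i _ => by ring) hr (by
      intro z hz t ht
      obtain ⟨x, -, hx⟩ := hN z z.2 hz
      refine ⟨x, fun _ => N, hx, ?_⟩
      rw [← Finset.sum_mul, hω_sum, one_mul]
      exact ht) (by
      rintro t ⟨x, a, hxa, hat⟩
      have h1 := (hxhat x).trans (primalObj_le_coe hω (a := a) fun i => by simpa using hxa i)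
      rw [hobj, EReal.coe_le_coe_iff] at h1
      exact h1.trans hat)
  obtain ⟨L, hL, -⟩ := exists_extension_norm_eq S ℓ
  -- Riesz representation coordinatewise; the factor 1/ω_i turns `L` into the weighted pairing.
  let y : Fin k → X := fun i => (ω i)⁻¹ • (InnerProductSpace.toDual ℝ X).symm
    (L.comp (ContinuousLinearMap.single ℝ (fun _ : Fin k => X) i))
  have hLy : ∀ z, L z = ∑ i, ω i * inner ℝ (y i) (z i) := by
    intro z
    conv_lhs => rw [← Finset.univ_sum_single z, map_sum]
    refine Finset.sum_congr rfl fun i _ => ?_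
    simp only [y, inner_smul_left, InnerProductSpace.toDual_symm_apply, conj_trivial]
    rw [mul_inv_cancel_left₀ (hω i).ne']
    rfl
  have key : ∀ (x : X) (A : Fin k → X) (a : Fin k → ℝ), (∀ i, g i (A i) ≤ a i) →
      ∑ i, ω i * p i + ∑ i, ω i * inner ℝ (y i) (A i - x) ≤ ∑ i, ω i * a i := by
    intro x A a hA
    have hz : (fun i => A i - x) ∈ S := by
      have h1 : (fun i => A i - x) ∈ (S : Set (Fin k → X)) := by
        rw [hcone]
        exact ⟨1, one_pos, fun i => A i - x,
          ⟨A, fun i => (hA i).trans_lt (EReal.coe_lt_top _), x, rfl⟩, by simp⟩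
      exact h1
    have h2 := hℓ ⟨_, hz⟩ (∑ i, ω i * a i) ⟨x, a, fun i => by simpa using hA i, le_rfl⟩
    rwa [← hL, hLy] at h2
  refine ⟨y, ?_, fun i => mem_subdifferential_iff.2 ⟨p i, hp i, fun z b hb => ?_⟩⟩
  -- Translating along the diagonal by ∑ ω_i y_i leaves the values `p` unchanged, so the square of
  -- its norm is ≤ 0.
  · have h1 := key (xhat - ∑ i, ω i • y i) (fun _ => xhat) p fun i => (hp i).le
    have h2 : ∑ i, ω i * inner ℝ (y i) (xhat - (xhat - ∑ i, ω i • y i))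
        = ‖∑ i, ω i • y i‖ ^ 2 := by
      rw [sub_sub_cancel, ← real_inner_self_eq_norm_sq, sum_inner]
      exact Finset.sum_congr rfl fun i _ => by rw [real_inner_smul_left (y i)]
    rw [h2] at h1
    change ∑ i, ω i • y i = 0
    rw [← norm_eq_zero]
    exact pow_eq_zero_iff two_ne_zero |>.1 (le_antisymm (by linarith) (sq_nonneg _))
  -- Moving only coordinate i isolates its subgradient inequality, multiplied by ω_i > 0.
  · have h1 := key xhat (Function.update (fun _ => xhat) i z) (Function.update p i b) (by
      intro j
      rcases eq_or_ne j i with rfl | hj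
      · simpa using hb
      · simpa [hj] using (hp j).le)
    have h2 : ∑ j, ω j * (Function.update p i b j - p j
        - inner ℝ (y j) (Function.update (fun _ => xhat) i z j - xhat))
        = ω i * (b - p i - inner ℝ (y i) (z - xhat)) := by
      rw [Finset.sum_eq_single i (fun j _ hj => by simp [hj]) (by simp)]
      simp
    simp only [mul_sub, Finset.sum_sub_distrib] at h2
    have h3 : 0 ≤ ω i * (b - p i - inner ℝ (y i) (z - xhat)) := by
      simp only [mul_sub]
      linarith
    have h4 := nonneg_of_mul_nonneg_right h3 (hω i)
    linarith

end Qualification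

end PrimalDual

/-! ### The main theorem -/

open PrimalDual
theorem theorem21 {X : Type*} [NormedAddCommGroup X] [InnerProductSpace ℝ X] [CompleteSpace X]
    {k : ℕ} (ω : Fin k → ℝ) (hω : ∀ i, 0 < ω i ∧ ω i ≤ 1) (hω_sum : ∑ i, ω i = 1)
    (g : Fin k → X → EReal) (hproper : ∀ i, IsProper (g i)) (hconvex : ∀ i, IsConvexFun (g i))
    (hlsc : ∀ i, LowerSemicontinuous (g i))
    (xhat : X) (hxhat : IsPrimalSolution ω g xhat)
    (hqc : QC1 g ∨ QC2 g ∨ QC3 g) :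
    -- (i) dual attainment, strong duality and the optimality system
    (∃ yhat : Fin k → X, IsDualSolution ω g yhat ∧ primalValue ω g = dualValue ω g ∧
      (∀ i, xhat ∈ subdifferential (conjugate (g i)) (yhat i)) ∧ ∑ i, ω i • yhat i = 0) ∧
    -- (ii) convergence of the first algorithm
    (FiniteDimensional ℝ X →
      ∀ (σ τ : ℝ), 0 < σ → 0 < τ → σ * τ < 1 →
      ∀ (x xbar : ℕ → X) (y : ℕ → Fin k → X), GeneratedByFirst ω g σ τ x xbar y →
        (∃ xstar, IsPrimalSolution ω g xstar ∧ Tendsto x atTop (𝓝 xstar)) ∧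
        (∃ ystar, IsDualSolution ω g ystar ∧ Tendsto y atTop (𝓝 ystar))) ∧
    -- (iii) convergence of the second algorithm
    (FiniteDimensional ℝ X →
      ∀ (σ τ : ℝ), 0 < σ → 0 < τ → σ * τ < 1 →
      ∀ (x xbar y : ℕ → Fin k → X), GeneratedBySecond ω g σ τ x xbar y →
        (∀ i, ∃ xstar, IsPrimalSolution ω g xstar ∧
          Tendsto (fun n => x n i) atTop (𝓝 xstar)) ∧
        (∃ ystar, IsDualSolution ω g ystar ∧ Tendsto y atTop (𝓝 ystar))) := by
  have hpos : ∀ i, 0 < ω i := fun i => (hω i).1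
  have hqc3 : QC3 g := by
    rcases hqc with h | h | h
    · exact h.qc2.qc3
    · exact h.qc3
    · exact h
  obtain ⟨yhat, hyhat, hsub⟩ :=
    exists_subdifferential_of_qc3 hpos hω_sum hproper hconvex hlsc hxhat hqc3
  have hZ : (saddleSet ω g).Nonempty := ⟨(fun _ => xhat, yhat), fun _ _ => rfl, hyhat, hsub⟩
  obtain ⟨-, hdual, hval⟩ := optimal_of_subdifferential hpos hproper hyhat hsub
  refine ⟨⟨yhat, hdual, hval, fun i => mem_subdifferential_conjugate (hsub i), hyhat⟩, ?_, ?_⟩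
  · intro _ σ τ hσ hτ hστ x xbar y h
    exact h.tendsto hpos hω_sum hproper hconvex hlsc hZ hσ hτ hστ
  · intro _ σ τ hσ hτ hστ x xbar y h
    exact h.tendsto hpos hω_sum hproper hconvex hlsc hZ hσ hτ hστ
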